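/- Let $n\ge 1$, and let $\mathrm{Sym}^d\mathbb{C}^2$ denote the space of complex binary forms of degree $d$ in $x,y$. Let $\nu_{2n}(\mathbb{P}^1)=\{[\ell^{2n}] : 0\ne \ell\in \mathrm{Sym}^1\mathbb{C}^2\}\subset \mathbb{P}^{2n}=\mathbb{P}(\mathrm{Sym}^{2n}\mathbb{C}^2)$ be the rational normal curve, and let $\sigma_n(\nu_{2n}(\mathbb{P}^1))$ be its $n$-th secant variety, i.e. the Zariski closure of the union of the linear spans of all $n$-tuples of its points. For $X\subset\mathbb{P}(V)$, the dual variety $X^\vee\subset\mathbb{P}(V^*)$ is the Zariski closure of the set of hyperplanes containing the embedded tangent space of $X$ at some smooth point. Identify $\mathbb{P}(\mathrm{Sym}^{2n}\mathbb{C}^2)$ with $\mathbb{P}((\mathrm{Sym}^{2n}\mathbb{C}^2)^*)$ by $f\mapsto Q(f,\cdot)$, where $Q$ is the Bombieri-Weyl form, $$Q\Big(\sum_{a+b=2n}\tbinom{2n}{a}f_{ab}\,x^ay^b,\ \sum_{a+b=2n}\tbinom{2n}{a}g_{ab}\,x^ay^b\Big)=\sum_{a+b=2n}\tbinom{2n}{a}f_{ab}\,g_{ab}.$$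 Then the dual variety of $\sigma_n(\nu_{2n}(\mathbb{P}^1))$ is the projectivization $\{[f^2] : 0\neq f\in\mathrm{Sym}^n\mathbb{C}^2\}$ of the variety of squares $Sq_n=\{f^2 : f\in\mathrm{Sym}^n\mathbb{C}^2\}\subset \mathrm{Sym}^{2n}\mathbb{C}^2$. Moreover, this projectivization is a smooth irreducible Zariski closed subvariety of $\mathbb{P}(\mathrm{Sym}^{2n}\mathbb{C}^2)$, and it is isomorphic to $\mathbb{P}^n$ as a projective variety. -/

import Mathlib

/-! ### Projective varieties in `ℙ(V)`, for a complex vector space `V`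

Points of `ℙ(V)` are elements of `Projectivization ℂ V`. All conditions below on a point `p` are
expressed with the representative vector `p.rep`; they involve only homogeneous polynomials, so
they do not depend on the choice of the representative. -/

section Varieties

variable {V : Type*} [AddCommGroup V] [Module ℂ V]
variable {W : Type*} [AddCommGroup W] [Module ℂ W]

/-- `F : V → ℂ` is a homogeneous polynomial function of degree `d`: it is a homogeneous polynomial
of degree `d` in (finitely many) linear functionals on `V`. -/
def IsForm (d : ℕ) (F : V → ℂ) : Prop :=
  ∃ P : MvPolynomial (Module.Dual ℂ V) ℂ, P.IsHomogeneous d ∧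
    ∀ v : V, F v = MvPolynomial.eval (fun l : Module.Dual ℂ V => l v) P

/-- `Φ : V → W` is a homogeneous polynomial map of degree `d`. -/
def IsFormMap (d : ℕ) (Φ : V → W) : Prop :=
  ∀ l : Module.Dual ℂ W, IsForm d (fun v => l (Φ v))

/-- The set of points of `ℙ(V)` represented by the nonzero elements of `C`
(the projectivization of `C`, when `C` is a cone). -/
def projectivize (C : Set V) : Set (Projectivization ℂ V) :=
  {p | ∃ (v : V) (hv : v ≠ 0), v ∈ C ∧ p = Projectivization.mk ℂ v hv}

/-- Zariski closed subsets of `ℙ(V)`: common zero loci of families of homogeneous polynomials. -/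
def IsZariskiClosed (X : Set (Projectivization ℂ V)) : Prop :=
  ∃ S : Set (V → ℂ), (∀ F ∈ S, ∃ d, IsForm d F) ∧ X = {p | ∀ F ∈ S, F p.rep = 0}

/-- The Zariski closure: the common zero locus of all homogeneous polynomials vanishing on `X`. -/
def zariskiClosure (X : Set (Projectivization ℂ V)) : Set (Projectivization ℂ V) :=
  {p | ∀ (d : ℕ) (F : V → ℂ), IsForm d F → (∀ q ∈ X, F q.rep = 0) → F p.rep = 0}

/-- Irreducibility in the Zariski topology. -/
def IsZariskiIrreducible (X : Set (Projectivization ℂ V)) : Prop :=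
  X.Nonempty ∧ ∀ Z₁ Z₂ : Set (Projectivization ℂ V), IsZariskiClosed Z₁ → IsZariskiClosed Z₂ →
    X ⊆ Z₁ ∪ Z₂ → X ⊆ Z₁ ∨ X ⊆ Z₂

/-- The embedded Zariski tangent space of `X` at `p`, as a subset of `V` (the tangent space to the
affine cone over `X` at `p.rep`): the common kernel of the differentials at `p.rep` of all
homogeneous polynomials vanishing on `X`. -/
def embeddedTangentSpace (X : Set (Projectivization ℂ V)) (p : Projectivization ℂ V) : Set V :=
  {w | ∀ (d : ℕ) (F : V → ℂ), IsForm d F → (∀ q ∈ X, F q.rep = 0) → lineDeriv ℂ F p.rep w = 0}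

/-- `p` is a smooth point of `X` (Jacobian criterion): `p ∈ X`, and in some Zariski open
neighbourhood of `p` (the complement of a closed set `Z`) the set `X` is the common zero locus of
finitely many homogeneous polynomials whose differentials at `p.rep` are linearly independent. -/
def IsSmoothPoint (X : Set (Projectivization ℂ V)) (p : Projectivization ℂ V) : Prop :=
  p ∈ X ∧ ∃ (k : ℕ) (F : Fin k → V → ℂ) (Z : Set (Projectivization ℂ V)),
    (∀ i, ∃ d, IsForm d (F i)) ∧
    LinearIndependent ℂ (fun (i : Fin k) (w : V) => lineDeriv ℂ (F i) p.rep w) ∧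
    IsZariskiClosed Z ∧ p ∉ Z ∧
    ∀ q, q ∉ Z → (q ∈ X ↔ ∀ i, F i q.rep = 0)

/-- Smooth (irreducible, projective) subvarieties of `ℙ(V)`. -/
def IsSmoothProjectiveVariety (X : Set (Projectivization ℂ V)) : Prop :=
  IsZariskiClosed X ∧ IsZariskiIrreducible X ∧ ∀ p ∈ X, IsSmoothPoint X p

/-- A map `X → Y` is regular if near every point `p` of `X` it is given by a homogeneous
polynomial map `Φ`. The neighbourhood is the locus in `X` where `Φ` does not vanish
(any smaller principal neighbourhood `G ≠ 0` is of this form, with `G • Φ` instead of `Φ`). -/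
def IsRegularMap {X : Set (Projectivization ℂ V)} {Y : Set (Projectivization ℂ W)}
    (φ : X → Y) : Prop :=
  ∀ p : X, ∃ (d : ℕ) (Φ : V → W), IsFormMap d Φ ∧ Φ p.1.rep ≠ 0 ∧
    ∀ (q : X) (hq : Φ q.1.rep ≠ 0), (φ q).1 = Projectivization.mk ℂ (Φ q.1.rep) hq

/-- Isomorphism of projective varieties: a bijection that is regular in both directions. -/
def IsIsomorphicTo (X : Set (Projectivization ℂ V)) (Y : Set (Projectivization ℂ W)) : Prop :=
  ∃ φ : X ≃ Y, IsRegularMap (φ : X → Y) ∧ IsRegularMap (φ.symm : Y → X)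

/-- The `r`-th secant variety `σ_r(X)`: the Zariski closure of the union of the linear spans of
all `r`-tuples of points of `X`. -/
def secantVariety (r : ℕ) (X : Set (Projectivization ℂ V)) : Set (Projectivization ℂ V) :=
  zariskiClosure {p | ∃ s : Fin r → Projectivization ℂ V, (∀ i, s i ∈ X) ∧
    p ∈ Projectivization.Subspace.span (Set.range s)}

/-- The projective dual variety `X^∨ ⊆ ℙ(V^*)`: the Zariski closure of the set of hyperplanes
that contain the tangent space of `X` at some smooth point. -/
def dualVariety (X : Set (Projectivization ℂ V)) :
    Set (Projectivization ℂ (Module.Dual ℂ V)) :=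
  zariskiClosure {H | ∃ p, IsSmoothPoint X p ∧ ∀ w ∈ embeddedTangentSpace X p, H.rep w = 0}

end Varieties

/-! ### Binary forms -/

/-- `Sym^d ℂ²`: binary forms of degree `d`, i.e. homogeneous polynomials of degree `d` in two
variables `X 0`, `X 1`. -/
abbrev BinaryForm (d : ℕ) : Type := MvPolynomial.homogeneousSubmodule (Fin 2) ℂ d

/-- The rational normal curve `ν_d(ℙ¹) ⊆ ℙ(Sym^d ℂ²)`: the classes of `d`-th powers of linear
forms. -/
def rationalNormalCurve (d : ℕ) : Set (Projectivization ℂ (BinaryForm d)) :=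
  projectivize {g | ∃ l : BinaryForm 1, l ≠ 0 ∧
    (g : MvPolynomial (Fin 2) ℂ) = (l : MvPolynomial (Fin 2) ℂ) ^ d}

/-- The variety of squares `Sq_n = {f² : f ∈ Sym^n ℂ²} ⊆ Sym^{2n} ℂ²`. -/
def squares (n : ℕ) : Set (BinaryForm (2 * n)) :=
  {g | ∃ f : BinaryForm n,
    (g : MvPolynomial (Fin 2) ℂ) = (f : MvPolynomial (Fin 2) ℂ) ^ 2}

/-- The coefficient of `x^a y^b`, as a linear functional on binary forms. -/
noncomputable def binaryCoeff (d : ℕ) (m : ℕ × ℕ) : Module.Dual ℂ (BinaryForm d) :=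
  (MvPolynomial.lcoeff ℂ (Finsupp.single 0 m.1 + Finsupp.single 1 m.2)).comp
    (MvPolynomial.homogeneousSubmodule (Fin 2) ℂ d).subtype

/-- The Bombieri-Weyl form
`Q(∑ (d choose a) f_{ab} x^a y^b, ∑ (d choose a) g_{ab} x^a y^b) = ∑ (d choose a) f_{ab} g_{ab}`,
sums over `a + b = d`. In terms of the plain coefficients `c_{ab}(f) = (d choose a) f_{ab}` it
is `∑ c_{ab}(f) c_{ab}(g) / (d choose a)`. -/
noncomputable def bombieriWeyl (d : ℕ) : LinearMap.BilinForm ℂ (BinaryForm d) :=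
  ∑ m ∈ Finset.HasAntidiagonal.antidiagonal d, ((d.choose m.1 : ℂ)⁻¹) •
    (binaryCoeff d m).smulRight (binaryCoeff d m)

theorem bombieriWeyl_apply (d : ℕ) (f g : BinaryForm d) :
    bombieriWeyl d f g = ∑ m ∈ Finset.HasAntidiagonal.antidiagonal d,
      ((d.choose m.1 : ℂ)⁻¹) * (binaryCoeff d m f * binaryCoeff d m g) := by
  simp [bombieriWeyl, LinearMap.sum_apply]

/-- The Bombieri-Weyl form is nondegenerate: `f ↦ Q(f, ·)` is injective. -/
theorem bombieriWeyl_injective (d : ℕ) : Function.Injective (bombieriWeyl d) := by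
  rw [← LinearMap.ker_eq_bot, LinearMap.ker_eq_bot']
  intro f hf
  apply Subtype.ext
  apply MvPolynomial.ext
  intro s
  by_cases hs : s.degree = d
  · have hmem : (MvPolynomial.monomial s (1 : ℂ)) ∈
        MvPolynomial.homogeneousSubmodule (Fin 2) ℂ d :=
      MvPolynomial.isHomogeneous_monomial 1 hs
    have h := LinearMap.congr_fun hf ⟨_, hmem⟩
    have hsum : s 0 + s 1 = d := by
      rw [← hs, Finsupp.degree_eq_sum, Fin.sum_univ_two]
    have key : ∀ m : ℕ × ℕ, Finsupp.single 0 m.1 + Finsupp.single 1 m.2 = s ↔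
        m = (s 0, s 1) := by
      intro m
      constructor
      · rintro rfl
        simp
      · rintro rfl
        ext i
        fin_cases i <;> simp
    have hc : ((d.choose (s 0) : ℂ)) ≠ 0 :=
      Nat.cast_ne_zero.mpr (Nat.choose_pos (by omega)).ne'
    rw [bombieriWeyl_apply, Finset.sum_eq_single (s 0, s 1)] at h
    · simpa [binaryCoeff, MvPolynomial.lcoeff, (key (s 0, s 1)).mpr rfl, hc] using h
    · intro m _ hm
      have : ¬ (s = Finsupp.single 0 m.1 + Finsupp.single 1 m.2) :=
        fun e => hm ((key m).mp e.symm)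
      simp [binaryCoeff, MvPolynomial.lcoeff, MvPolynomial.coeff_monomial, this]
    · intro hn
      exact absurd (Finset.HasAntidiagonal.mem_antidiagonal.mpr hsum) hn
  · have h0 := f.2
    rw [MvPolynomial.mem_homogeneousSubmodule] at h0
    simpa using h0.coeff_eq_zero hs

/-!
Let `V = Sym^{2n} ℂ²` and let `Q` be the Bombieri–Weyl form on `V`. Since `Q(ℓ^{2n}, h)` is the
value of `h` at the point of `ℂ²` given by the coefficients of `ℓ` (`bombieriWeyl_powForm`),
everything is governed by apolarity: `g ∈ Sym^n` is apolar to `p ∈ V` if `Q(p, g m) = 0` for all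
`m ∈ Sym^n`, that is, if `g` is in the kernel of the catalecticant (Hankel) matrix of `p`.

*The secant variety.* If `g` has distinct roots, a form is apolar to `g` exactly when it is a
combination of the `n` powers `ℓ_i^{2n}` dual to these roots (`exists_eq_sum_powForm`). Pairs
`(p, g)` with `g` of this kind are dense among all apolar pairs: move the roots of `g`, and let `p`
follow by Cramer's rule (`exists_apolar_curve`). Hence the secant variety is the catalecticant
hypersurface, `mem_secantVariety_iff`.

*Conormal directions.* Let a form `F` vanish on the secant variety. At a general
`p = ∑ c_i ℓ_i^{2n}` the differential of `F` is `Q(h, ·)` for some `h`; moving each `ℓ_i` shows that `h` vanishes to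
second order at the roots of the apolar form `g`, so that `h` is a multiple of `g²`. The condition
that `dF_p` be proportional to `Q(g², ·)` is closed, so it holds for every apolar pair
(`vanishing_and_differential_of_apolar`), without any distinction between smooth and singular
points. Thus a hyperplane containing the tangent space at `p` is `Q(g², ·)`, up to a scalar, for
every `g` apolar to `p`. Conversely, for `g` with distinct roots the point `∑ ℓ_i^{2n}` is smooth,
because the catalecticant determinant has nonzero derivative there (`isSmoothPoint_sum_powForm`), and
every `f²` is a limit of such `g²`.

*Squares.* Near a form not vanishing at `(a, 1)`, a square root is given by the Taylor expansion of
the square root, which after clearing denominators is a homogeneous polynomial map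
`sqrtForm n a : Sym^{2n} → Sym^n`. It inverts `[f] ↦ [f²]`, and comparing `h` with the square of
`sqrtForm n a h` gives the equations `squareEqn n a`. These cut out the squares where the value at
`(a, 1)` is nonzero and hold on all squares; they are affine linear in the last `n` coefficients, so
their differentials are independent. This gives closedness, smoothness, and the isomorphism with
`ℙ^n`; irreducibility holds because `ℙ^n` is irreducible.
-/

/-! ### Homogeneous polynomial functions -/

section Forms

open MvPolynomial

variable {V : Type*} [AddCommGroup V] [Module ℂ V]
variable {W : Type*} [AddCommGroup W] [Module ℂ W]
variable {U : Type*} [AddCommGroup U] [Module ℂ U]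

theorem MvPolynomial.IsHomogeneous.eval_mul_left {σ R : Type*} [CommSemiring R]
    {P : MvPolynomial σ R} {d : ℕ} (hP : P.IsHomogeneous d) (c : R) (x : σ → R) :
    eval (fun i => c * x i) P = c ^ d * eval x P := by
  rw [eval_eq, eval_eq, Finset.mul_sum]
  refine Finset.sum_congr rfl fun s hs => ?_
  have hd : ∑ i ∈ s.support, s i = d := by
    simpa [Finsupp.degree] using hP.degree_eq_sum_deg_support hs |>.symm
  simp_rw [mul_pow, Finset.prod_mul_distrib, Finset.prod_pow_eq_pow_sum, hd]
  ring

theorem isForm_const (c : ℂ) : IsForm 0 (fun _ : V => c) :=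
  ⟨C c, isHomogeneous_C _ _, fun v => by simp⟩

theorem isForm_dual (l : Module.Dual ℂ V) : IsForm 1 (fun v => l v) :=
  ⟨X l, isHomogeneous_X _ _, fun v => by simp⟩

theorem isForm_zero (d : ℕ) : IsForm d (fun _ : V => 0) :=
  ⟨0, isHomogeneous_zero _ _ _, fun v => by simp⟩

namespace IsForm

variable {d e : ℕ} {F G : V → ℂ}

theorem add (hF : IsForm d F) (hG : IsForm d G) : IsForm d (fun v => F v + G v) := by
  obtain ⟨P, hP, hPF⟩ := hF
  obtain ⟨R, hR, hRG⟩ := hG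
  exact ⟨P + R, hP.add hR, fun v => by simp [hPF, hRG]⟩

theorem const_mul (hF : IsForm d F) (c : ℂ) : IsForm d (fun v => c * F v) := by
  obtain ⟨P, hP, hPF⟩ := hF
  exact ⟨C c * P, hP.C_mul c, fun v => by simp [hPF]⟩

theorem mul (hF : IsForm d F) (hG : IsForm e G) : IsForm (d + e) (fun v => F v * G v) := by
  obtain ⟨P, hP, hPF⟩ := hF
  obtain ⟨R, hR, hRG⟩ := hG
  exact ⟨P * R, hP.mul hR, fun v => by simp [hPF, hRG]⟩

theorem pow (hF : IsForm d F) (k : ℕ) : IsForm (d * k) (fun v => F v ^ k) := by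
  obtain ⟨P, hP, hPF⟩ := hF
  exact ⟨P ^ k, hP.pow k, fun v => by simp [hPF]⟩

theorem sum {ι : Type*} (s : Finset ι) {F : ι → V → ℂ} (hF : ∀ i ∈ s, IsForm d (F i)) :
    IsForm d (fun v => ∑ i ∈ s, F i v) := by
  induction s using Finset.cons_induction with
  | empty => simpa using isForm_zero d
  | cons a s ha ih =>
    simp_rw [Finset.sum_cons]
    exact (hF a (by simp)).add (ih fun i hi => hF i (by simp [hi]))

theorem prod {ι : Type*} (s : Finset ι) {F : ι → V → ℂ} (hF : ∀ i ∈ s, IsForm d (F i)) :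
    IsForm (d * s.card) (fun v => ∏ i ∈ s, F i v) := by
  induction s using Finset.cons_induction with
  | empty => simpa using isForm_const (V := V) 1
  | cons a s ha ih =>
    simp_rw [Finset.prod_cons, Finset.card_cons, mul_add, mul_one, add_comm (d * _)]
    exact (hF a (by simp)).mul (ih fun i hi => hF i (by simp [hi]))

theorem det {k : ℕ} {M : V → Matrix (Fin k) (Fin k) ℂ} (hM : ∀ i j, IsForm 1 (fun v => M v i j)) :
    IsForm k (fun v => (M v).det) := by
  simp_rw [Matrix.det_apply']
  refine sum _ fun σ _ => const_mul ?_ _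
  simpa using prod Finset.univ (F := fun i v => M v (σ i) i) fun i _ => hM _ _

theorem comp {Φ : U → V} (hF : IsForm d F) (hΦ : IsFormMap e Φ) :
    IsForm (e * d) (fun u => F (Φ u)) := by
  obtain ⟨P, hP, hPF⟩ := hF
  choose R hR hRΦ using hΦ
  refine ⟨aeval R P, hP.aeval R hR, fun u => ?_⟩
  have h : (fun l : Module.Dual ℂ V => l (Φ u)) =
      fun l => aeval (fun m : Module.Dual ℂ U => m u) (R l) := by
    funext l
    simpa [MvPolynomial.aeval_eq_eval] using hRΦ l u
  have := DFunLike.congr_fun (comp_aeval (R := ℂ) R (aeval fun m : Module.Dual ℂ U => m u)) P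
  rw [← h] at this
  simpa [hPF, MvPolynomial.aeval_eq_eval] using this.symm

theorem map_smul (hF : IsForm d F) (c : ℂ) (v : V) : F (c • v) = c ^ d * F v := by
  obtain ⟨P, hP, hPF⟩ := hF
  simp_rw [hPF, ← hP.eval_mul_left, LinearMap.map_smul, smul_eq_mul]

/-- The vanishing of a form at a point of projective space may be tested on any representative. -/
theorem rep_mk_eq_zero_iff (hF : IsForm d F) (v : V) (hv : v ≠ 0) :
    F (Projectivization.mk ℂ v hv).rep = 0 ↔ F v = 0 := by
  obtain ⟨a, ha⟩ := Projectivization.exists_smul_eq_mk_rep ℂ v hv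
  rw [← ha, Units.smul_def, hF.map_smul]
  simp

/-- A form restricts to a polynomial on every affine line. -/
theorem exists_polynomial (hF : IsForm d F) (v w : V) :
    ∃ p : Polynomial ℂ, ∀ t, F (v + t • w) = p.eval t := by
  obtain ⟨P, hP, hPF⟩ := hF
  refine ⟨aeval (fun l : Module.Dual ℂ V =>
    Polynomial.C (l v) + Polynomial.X * Polynomial.C (l w)) P, fun t => ?_⟩
  have := DFunLike.congr_fun (comp_aeval (R := ℂ) (fun l : Module.Dual ℂ V =>
    Polynomial.C (l v) + Polynomial.X * Polynomial.C (l w)) (Polynomial.aeval t)) P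
  simp only [map_add, map_mul, Polynomial.aeval_C, Polynomial.aeval_X, Algebra.algebraMap_self,
    RingHom.id_apply, AlgHom.comp_apply, MvPolynomial.aeval_eq_eval,
    Polynomial.coe_aeval_eq_eval] at this
  simpa [hPF] using this.symm

/-- The nonvanishing loci of two forms meet, unless one of them is empty. -/
theorem exists_ne_zero (hF : IsForm d F) (hG : IsForm e G) {v w : V} (hv : F v ≠ 0)
    (hw : G w ≠ 0) : ∃ u, F u ≠ 0 ∧ G u ≠ 0 := by
  obtain ⟨p, hp⟩ := hF.exists_polynomial v (w - v)
  obtain ⟨q, hq⟩ := hG.exists_polynomial v (w - v)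
  have hp0 : p ≠ 0 := by
    rintro rfl
    exact hv (by simpa using hp 0)
  have hq0 : q ≠ 0 := by
    rintro rfl
    exact hw (by simpa using hq 1)
  obtain ⟨t, ht⟩ : ∃ t, (p * q).eval t ≠ 0 := by
    by_contra! h
    exact mul_ne_zero hp0 hq0 (Polynomial.funext (by simpa using h))
  rw [Polynomial.eval_mul, mul_ne_zero_iff] at ht
  exact ⟨v + t • (w - v), by rw [hp]; exact ht.1, by rw [hq]; exact ht.2⟩

/-- The derivative of a form along a weakly differentiable curve is given by the formal derivation
that sends each coordinate function `l` to the constant `l w`. -/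
theorem exists_hasDerivAt_comp (hF : IsForm d F) : ∃ P : MvPolynomial (Module.Dual ℂ V) ℂ,
    ∀ (γ : ℂ → V) (w : V) (t₀ : ℂ),
      (∀ l : Module.Dual ℂ V, HasDerivAt (fun t => l (γ t)) (l w) t₀) →
      HasDerivAt (fun t => F (γ t)) (eval (fun l : Module.Dual ℂ V => l (γ t₀))
        (mkDerivation ℂ (fun l : Module.Dual ℂ V => C (l w)) P)) t₀ := by
  obtain ⟨P, -, hPF⟩ := hF
  refine ⟨P, fun γ w t₀ hγ => ?_⟩
  simp_rw [hPF]
  clear hPF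
  induction P using MvPolynomial.induction_on with
  | C a => simpa using hasDerivAt_const t₀ a
  | add p q hp hq =>
    simp only [map_add]
    exact hp.add hq
  | mul_X p l hp =>
    have := hp.mul (hγ l)
    simp only [map_mul, eval_X]
    convert! this using 1
    simp [Derivation.leibniz, mkDerivation_X]
    ring

theorem exists_lineDeriv_eq (hF : IsForm d F) : ∃ P : MvPolynomial (Module.Dual ℂ V) ℂ,
    ∀ v w, lineDeriv ℂ F v w = eval (fun l : Module.Dual ℂ V => l v)
      (mkDerivation ℂ (fun l : Module.Dual ℂ V => C (l w)) P) := by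
  obtain ⟨P, hP⟩ := hF.exists_hasDerivAt_comp
  refine ⟨P, fun v w => ?_⟩
  have := hP (fun t => v + t • w) w 0 fun l => by
    simpa using ((hasDerivAt_id (0 : ℂ)).mul_const (l w)).const_add (l v)
  have h : HasLineDerivAt ℂ F _ v w := this
  rw [h.lineDeriv]
  simp

/-- The chain rule for a form along a curve in `V` that is differentiable in the weak sense, after
composition with every linear functional. No topology on `V` is needed. -/
theorem hasDerivAt_comp (hF : IsForm d F) {γ : ℂ → V} {w : V} {t₀ : ℂ}
    (hγ : ∀ l : Module.Dual ℂ V, HasDerivAt (fun t => l (γ t)) (l w) t₀) :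
    HasDerivAt (fun t => F (γ t)) (lineDeriv ℂ F (γ t₀) w) t₀ := by
  obtain ⟨P, hP⟩ := hF.exists_hasDerivAt_comp
  have h := hP (fun t => γ t₀ + t • w) w 0 fun l => by
    simpa using ((hasDerivAt_id (0 : ℂ)).mul_const (l w)).const_add (l (γ t₀))
  have hline : lineDeriv ℂ F (γ t₀) w = _ := h.deriv
  simpa [hline] using hP γ w t₀ hγ

/-- The differential of a form at a point. -/
noncomputable def differential (hF : IsForm d F) (v : V) : Module.Dual ℂ V where
  toFun w := lineDeriv ℂ F v w
  map_add' w₁ w₂ := by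
    obtain ⟨P, hP⟩ := hF.exists_lineDeriv_eq
    have : mkDerivation ℂ (fun l : Module.Dual ℂ V =>
        (C (l (w₁ + w₂)) : MvPolynomial (Module.Dual ℂ V) ℂ)) =
        mkDerivation ℂ (fun l : Module.Dual ℂ V => C (l w₁)) +
          mkDerivation ℂ (fun l : Module.Dual ℂ V => C (l w₂)) := by
      ext l
      simp [mkDerivation_X]
    rw [hP v _, hP v _, hP v _, this]
    simp
  map_smul' c w := by
    obtain ⟨P, hP⟩ := hF.exists_lineDeriv_eq
    have : mkDerivation ℂ (fun l : Module.Dual ℂ V =>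
        (C (l (c • w)) : MvPolynomial (Module.Dual ℂ V) ℂ)) =
        c • mkDerivation ℂ (fun l : Module.Dual ℂ V => C (l w)) := by
      ext l
      simp [mkDerivation_X, smul_eq_C_mul]
    rw [hP v _, hP v _, this]
    simp

theorem differential_apply (hF : IsForm d F) (v w : V) :
    hF.differential v w = lineDeriv ℂ F v w := rfl

/-- A form is continuous along every weakly continuous curve. -/
theorem continuous_comp (hF : IsForm d F) {γ : ℂ → V}
    (hγ : ∀ l : Module.Dual ℂ V, Continuous fun t => l (γ t)) : Continuous fun t => F (γ t) := by
  obtain ⟨P, -, hPF⟩ := hF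
  simp_rw [hPF]
  exact (MvPolynomial.continuous_eval P).comp (continuous_pi hγ)

theorem continuous_differential_comp (hF : IsForm d F) {γ : ℂ → V}
    (hγ : ∀ l : Module.Dual ℂ V, Continuous fun t => l (γ t)) (w : V) :
    Continuous fun t => hF.differential (γ t) w := by
  obtain ⟨P, hP⟩ := hF.exists_lineDeriv_eq
  simp_rw [differential_apply, hP _ w]
  exact (MvPolynomial.continuous_eval _).comp (continuous_pi hγ)

end IsForm

/-- Homogeneous polynomial maps of degree `d` with values in a finite-dimensional subspace: the
span of the maps `v ↦ F v • w`, for `F` a form of degree `d`. In this description, closure under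
sums, linear maps and products needs no choice of coordinates. -/
def formMaps (V W : Type*) [AddCommGroup V] [Module ℂ V] [AddCommGroup W] [Module ℂ W] (d : ℕ) :
    Submodule ℂ (V → W) :=
  Submodule.span ℂ {Φ | ∃ (F : V → ℂ) (w : W), IsForm d F ∧ Φ = fun v => F v • w}

theorem smul_mem_formMaps {d : ℕ} {F : V → ℂ} (hF : IsForm d F) (w : W) :
    (fun v => F v • w) ∈ formMaps V W d :=
  Submodule.subset_span ⟨F, w, hF, rfl⟩

theorem isFormMap_of_mem {d : ℕ} {Φ : V → W} (h : Φ ∈ formMaps V W d) : IsFormMap d Φ := by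
  intro l
  induction h using Submodule.span_induction with
  | mem Φ h =>
    obtain ⟨F, w, hF, rfl⟩ := h
    simpa [mul_comm] using hF.const_mul (l w)
  | zero => simpa using isForm_zero d
  | add Φ Ψ _ _ h₁ h₂ => simpa using h₁.add h₂
  | smul c Φ _ h => simpa using h.const_mul c

theorem comp_mem_formMaps {d : ℕ} {Φ : V → W} (h : Φ ∈ formMaps V W d) (L : W →ₗ[ℂ] U) :
    (fun v => L (Φ v)) ∈ formMaps V U d := by
  induction h using Submodule.span_induction with
  | mem Φ h =>
    obtain ⟨F, w, hF, rfl⟩ := h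
    simpa using smul_mem_formMaps hF (L w)
  | zero =>
    simp only [Pi.zero_apply, map_zero]
    exact zero_mem _
  | add Φ Ψ _ _ h₁ h₂ =>
    simp only [Pi.add_apply, map_add]
    exact add_mem h₁ h₂
  | smul c Φ _ h =>
    simp only [Pi.smul_apply, LinearMap.map_smul]
    exact Submodule.smul_mem _ c h

/-- Bilinear combinations of homogeneous polynomial maps. -/
theorem bilin_mem_formMaps {d e : ℕ} {T : Type*} [AddCommGroup T] [Module ℂ T] {Φ : V → W}
    {Ψ : V → U} (hΦ : Φ ∈ formMaps V W d) (hΨ : Ψ ∈ formMaps V U e) (B : W →ₗ[ℂ] U →ₗ[ℂ] T) :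
    (fun v => B (Φ v) (Ψ v)) ∈ formMaps V T (d + e) := by
  induction hΦ using Submodule.span_induction with
  | mem Φ h =>
    obtain ⟨F, w, hF, rfl⟩ := h
    induction hΨ using Submodule.span_induction with
    | mem Ψ h =>
      obtain ⟨G, u, hG, rfl⟩ := h
      have : (fun v => B (F v • w) (G v • u)) = fun v => (F v * G v) • B w u := by
        funext v
        rw [LinearMap.map_smul, LinearMap.map_smul, LinearMap.smul_apply, smul_smul, mul_comm]
      rw [this]
      exact smul_mem_formMaps (hF.mul hG) (B w u)
    | zero =>
      simp only [Pi.zero_apply, map_zero]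
      exact zero_mem _
    | add Φ Ψ _ _ h₁ h₂ =>
      simp only [Pi.add_apply, map_add]
      exact add_mem h₁ h₂
    | smul c Φ _ h =>
      simp only [Pi.smul_apply, LinearMap.map_smul] at h ⊢
      exact Submodule.smul_mem _ c h
  | zero =>
    simp only [Pi.zero_apply, map_zero, LinearMap.zero_apply]
    exact zero_mem _
  | add Φ Ψ _ _ h₁ h₂ =>
    simp only [Pi.add_apply, map_add, LinearMap.add_apply]
    exact add_mem h₁ h₂
  | smul c Φ _ h =>
    simp only [Pi.smul_apply, LinearMap.map_smul, LinearMap.smul_apply]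
    exact Submodule.smul_mem _ c h

theorem mul_mem_formMaps {d e : ℕ} {A : Type*} [CommRing A] [Algebra ℂ A] {Φ Ψ : V → A}
    (hΦ : Φ ∈ formMaps V A d) (hΨ : Ψ ∈ formMaps V A e) :
    (fun v => Φ v * Ψ v) ∈ formMaps V A (d + e) :=
  bilin_mem_formMaps hΦ hΨ (LinearMap.mul ℂ A)

theorem pow_mem_formMaps {d : ℕ} {A : Type*} [CommRing A] [Algebra ℂ A] {Φ : V → A}
    (hΦ : Φ ∈ formMaps V A d) (k : ℕ) : (fun v => Φ v ^ k) ∈ formMaps V A (d * k) := by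
  induction k with
  | zero => simpa using smul_mem_formMaps (isForm_const (V := V) 1) (1 : A)
  | succ k ih =>
    simp_rw [pow_succ]
    exact mul_mem_formMaps ih hΦ

theorem id_mem_formMaps [FiniteDimensional ℂ V] : (fun v : V => v) ∈ formMaps V V 1 := by
  let b := Module.finBasis ℂ V
  have : (fun v : V => v) = ∑ i, fun v : V => b.coord i v • b i := by
    funext v
    simp [b.sum_repr]
  rw [this]
  exact sum_mem fun i _ => smul_mem_formMaps (isForm_dual _) _

end Forms

/-! ### Points and spans in projective space -/

section Projective

variable {V : Type*} [AddCommGroup V] [Module ℂ V]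

theorem mem_span_iff_rep_mem (S : Set (Projectivization ℂ V)) (p : Projectivization ℂ V) :
    p ∈ Projectivization.Subspace.span S ↔
      p.rep ∈ Submodule.span ℂ (Projectivization.rep '' S) := by
  constructor
  · intro hp
    have h : Projectivization.Subspace.span S ≤
        (Submodule.span ℂ (Projectivization.rep '' S)).projectivization := by
      rw [Projectivization.Subspace.span_le_subspace_iff]
      intro q hq
      change q ∈ Submodule.projectivization _
      rw [← q.mk_rep, Submodule.mk_mem_projectivization_iff]
      exact Submodule.subset_span ⟨q, hq, rfl⟩
    have := h hp
    rwa [← p.mk_rep, Submodule.mk_mem_projectivization_iff] at this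
  · intro hp
    have h : Submodule.span ℂ (Projectivization.rep '' S) ≤
        Projectivization.Subspace.submodule (Projectivization.Subspace.span S) := by
      rw [Submodule.span_le]
      rintro _ ⟨q, hq, rfl⟩
      rw [SetLike.mem_coe, Projectivization.Subspace.mem_submodule_iff _ q.rep_nonzero, q.mk_rep]
      exact Projectivization.Subspace.subset_span _ hq
    have := h hp
    rwa [Projectivization.Subspace.mem_submodule_iff _ p.rep_nonzero, p.mk_rep] at this

theorem subset_zariskiClosure (X : Set (Projectivization ℂ V)) : X ⊆ zariskiClosure X :=
  fun _ hp _ _ _ h => h _ hp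

/-- A set and its Zariski closure lie on the same hypersurfaces. -/
theorem IsForm.vanishes_on_zariskiClosure_iff {d : ℕ} {F : V → ℂ} (hF : IsForm d F)
    (X : Set (Projectivization ℂ V)) :
    (∀ q ∈ zariskiClosure X, F q.rep = 0) ↔ ∀ q ∈ X, F q.rep = 0 :=
  ⟨fun h q hq => h q (subset_zariskiClosure X hq), fun h _ hq => hq d F hF h⟩

end Projective

/-! ### Binary forms: dehomogenization, roots and factorization -/

section BinaryForms

open MvPolynomial

instance (d : ℕ) : FiniteDimensional ℂ (BinaryForm d) :=
  Module.Finite.iff_fg.mpr (homogeneousSubmodule_fg (Fin 2) ℂ d)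

/-- Dehomogenization of a polynomial in two variables, centred at the point `(a, 1)`:
`f ↦ f (X + a, 1)`. -/
noncomputable def dehom (a : ℂ) : MvPolynomial (Fin 2) ℂ →ₐ[ℂ] Polynomial ℂ :=
  aeval ![Polynomial.X + Polynomial.C a, 1]

theorem eval_dehom (a z : ℂ) (f : MvPolynomial (Fin 2) ℂ) :
    (dehom a f).eval z = eval ![z + a, 1] f := by
  have := DFunLike.congr_fun (comp_aeval (R := ℂ) ![Polynomial.X + Polynomial.C a, 1]
    (Polynomial.aeval z)) f
  have h : (fun i => Polynomial.aeval z ((![Polynomial.X + Polynomial.C a, 1] :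
      Fin 2 → Polynomial ℂ) i)) = ![z + a, 1] := by
    funext i
    fin_cases i <;> simp
  rw [h, AlgHom.comp_apply, MvPolynomial.aeval_eq_eval, Polynomial.coe_aeval_eq_eval] at this
  exact this

theorem coeff_zero_dehom (a : ℂ) (f : MvPolynomial (Fin 2) ℂ) :
    (dehom a f).coeff 0 = eval ![a, 1] f := by
  rw [Polynomial.coeff_zero_eq_eval_zero, eval_dehom, zero_add]

theorem eq_zero_of_dehom_eq_zero {d : ℕ} {f : MvPolynomial (Fin 2) ℂ} (hf : f.IsHomogeneous d)
    {a : ℂ} (h : dehom a f = 0) : f = 0 := by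
  have hX : X 1 * f = 0 := by
    refine MvPolynomial.funext fun x => ?_
    rw [map_mul, eval_X, map_zero]
    by_cases hx : x 1 = 0
    · rw [hx, zero_mul]
    · have h1 := eval_dehom a (x 0 / x 1 - a) f
      have h2 : x = fun i => x 1 * (![x 0 / x 1 - a + a, 1] : Fin 2 → ℂ) i := by
        funext i
        fin_cases i
        · simp
          field_simp
        · simp
      rw [h, Polynomial.eval_zero] at h1
      rw [h2, hf.eval_mul_left, ← h1, mul_zero, mul_zero]
  exact (mul_eq_zero.mp hX).resolve_left (X_ne_zero 1)

theorem natDegree_dehom_le {d : ℕ} {f : MvPolynomial (Fin 2) ℂ} (hf : f.IsHomogeneous d) (a : ℂ) :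
    (dehom a f).natDegree ≤ d := by
  have := aeval_natDegree_le (n := 1) f hf.totalDegree_le ![Polynomial.X + Polynomial.C a, 1]
    (by intro i; fin_cases i <;> simp)
  rwa [mul_one] at this

/-- The binary form `(X 0 - a X 1)^k (X 1)^(d-k)`, which dehomogenizes to `X ^ k`. -/
noncomputable def shiftedMonomial (d : ℕ) (a : ℂ) (k : ℕ) : MvPolynomial (Fin 2) ℂ :=
  (X 0 - C a * X 1) ^ k * X 1 ^ (d - k)

theorem isHomogeneous_shiftedMonomial {d k : ℕ} (a : ℂ) (hk : k ≤ d) :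
    (shiftedMonomial d a k).IsHomogeneous d := by
  have h1 : (X 0 - C a * X 1 : MvPolynomial (Fin 2) ℂ).IsHomogeneous 1 :=
    (isHomogeneous_X _ _).sub (isHomogeneous_C_mul_X _ _)
  have := (h1.pow k).mul (isHomogeneous_X_pow (R := ℂ) (1 : Fin 2) (d - k))
  rwa [one_mul, Nat.add_sub_cancel' hk] at this

theorem dehom_shiftedMonomial (d : ℕ) (a : ℂ) (k : ℕ) :
    dehom a (shiftedMonomial d a k) = Polynomial.X ^ k := by
  simp [dehom, shiftedMonomial, ← Polynomial.algebraMap_eq]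

theorem eq_sum_shiftedMonomial {d : ℕ} {f : MvPolynomial (Fin 2) ℂ} (hf : f.IsHomogeneous d)
    (a : ℂ) : f = ∑ k ∈ Finset.range (d + 1), C ((dehom a f).coeff k) * shiftedMonomial d a k := by
  rw [← sub_eq_zero]
  refine eq_zero_of_dehom_eq_zero (d := d) (a := a) (hf.sub (IsHomogeneous.sum _ _ _ ?_)) ?_
  · intro k hk
    exact (isHomogeneous_shiftedMonomial a (Finset.mem_range_succ_iff.mp hk)).C_mul _
  · rw [map_sub, map_sum, sub_eq_zero]
    simp_rw [map_mul, dehom_shiftedMonomial]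
    have hC : ∀ c : ℂ, dehom a (C c) = Polynomial.C c := fun c => by
      simp [dehom, ← Polynomial.algebraMap_eq]
    simp_rw [hC]
    exact Polynomial.as_sum_range_C_mul_X_pow' _ (Nat.lt_succ_of_le (natDegree_dehom_le hf a))

/-- The linear form vanishing at the point `r`. -/
noncomputable def perp (r : Fin 2 → ℂ) : MvPolynomial (Fin 2) ℂ := C (r 1) * X 0 - C (r 0) * X 1

/-- The determinant of two vectors in `ℂ²`; nonzero if and only if the points of `ℙ¹` they
represent are distinct. -/
def det₂ (r s : Fin 2 → ℂ) : ℂ := r 1 * s 0 - r 0 * s 1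

theorem eval_perp (r s : Fin 2 → ℂ) : eval s (perp r) = det₂ r s := by
  simp [perp, det₂]

theorem isHomogeneous_perp (r : Fin 2 → ℂ) : (perp r).IsHomogeneous 1 :=
  (isHomogeneous_C_mul_X _ _).sub (isHomogeneous_C_mul_X _ _)

theorem perp_ne_zero {r : Fin 2 → ℂ} (hr : r ≠ 0) : perp r ≠ 0 := by
  intro h
  apply hr
  have h0 := eval_perp r ![0, 1]
  have h1 := eval_perp r ![1, 0]
  simp only [h, map_zero, det₂] at h0 h1
  funext i
  fin_cases i
  · simpa using h0.symm
  · simpa using h1.symm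

/-- A binary form vanishing at a point is divisible by the corresponding linear form. -/
theorem exists_eq_perp_mul {d : ℕ} {f : MvPolynomial (Fin 2) ℂ} (hf : f.IsHomogeneous (d + 1))
    {r : Fin 2 → ℂ} (hr : r ≠ 0) (h : eval r f = 0) :
    ∃ g : MvPolynomial (Fin 2) ℂ, g.IsHomogeneous d ∧ f = perp r * g := by
  by_cases h1 : r 1 = 0
  · have h0 : r 0 ≠ 0 := fun h0 => hr (by funext i; fin_cases i <;> assumption)
    refine ⟨C (-(r 0)⁻¹) * ∑ k ∈ Finset.range (d + 1), C ((dehom 0 f).coeff k) *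
      shiftedMonomial d 0 k, (IsHomogeneous.sum _ _ _ fun k hk =>
        (isHomogeneous_shiftedMonomial 0 (Finset.mem_range_succ_iff.mp hk)).C_mul _).C_mul _, ?_⟩
    have hf' := eq_sum_shiftedMonomial hf 0
    rw [Finset.sum_range_succ] at hf'
    have hX : ∀ k ∈ Finset.range (d + 1), shiftedMonomial (d + 1) 0 k =
        X 1 * shiftedMonomial d 0 k := by
      intro k hk
      rw [Finset.mem_range] at hk
      rw [shiftedMonomial, shiftedMonomial, show d + 1 - k = (d - k) + 1 by omega]
      ring
    have hlast : (dehom 0 f).coeff (d + 1) = 0 := by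
      have hev := congrArg (eval r) hf'
      rw [h, map_add, map_sum, Finset.sum_eq_zero] at hev
      · simpa [shiftedMonomial, h0] using hev
      · intro k hk
        rw [map_mul, hX k hk]
        simp [h1]
    have hperp : perp r * C (-(r 0)⁻¹) = X 1 := by
      have : (C (r 0) * C (r 0)⁻¹ : MvPolynomial (Fin 2) ℂ) = 1 := by
        rw [← C_mul, mul_inv_cancel₀ h0, C_1]
      simp only [perp, h1, C_0, zero_mul, zero_sub, C_neg]
      linear_combination X 1 * this
    rw [← mul_assoc, hperp, Finset.mul_sum]
    nth_rewrite 1 [hf']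
    rw [hlast, C_0, zero_mul, add_zero]
    exact Finset.sum_congr rfl fun k hk => by rw [hX k hk]; ring
  · set a := r 0 / r 1
    refine ⟨C (r 1)⁻¹ * ∑ k ∈ Finset.range (d + 1), C ((dehom a f).coeff (k + 1)) *
      shiftedMonomial d a k, (IsHomogeneous.sum _ _ _ fun k hk =>
        (isHomogeneous_shiftedMonomial a (Finset.mem_range_succ_iff.mp hk)).C_mul _).C_mul _, ?_⟩
    have hf' := eq_sum_shiftedMonomial hf a
    rw [Finset.sum_range_succ'] at hf'
    have hr' : r = fun i => r 1 * (![a, 1] : Fin 2 → ℂ) i := by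
      funext i
      fin_cases i
      · simp [a]
        field_simp
      · simp
    have hfirst : (dehom a f).coeff 0 = 0 := by
      rw [hr', hf.eval_mul_left] at h
      rw [coeff_zero_dehom]
      exact (mul_eq_zero.mp h).resolve_left (pow_ne_zero _ h1)
    have hperp : perp r * C (r 1)⁻¹ = X 0 - C a * X 1 := by
      have : (C (r 1) * C (r 1)⁻¹ : MvPolynomial (Fin 2) ℂ) = 1 := by
        rw [← C_mul, mul_inv_cancel₀ h1, C_1]
      simp only [perp, a, div_eq_mul_inv, C_mul]
      linear_combination X 0 * this
    rw [← mul_assoc, hperp, Finset.mul_sum]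
    nth_rewrite 1 [hf']
    rw [hfirst, C_0, zero_mul, add_zero]
    refine Finset.sum_congr rfl fun k _ => ?_
    rw [shiftedMonomial, shiftedMonomial, show d + 1 - (k + 1) = d - k by omega]
    ring

/-- A binary form of positive degree has a root on the projective line. -/
theorem exists_root {d : ℕ} {f : MvPolynomial (Fin 2) ℂ} (hf : f.IsHomogeneous (d + 1)) :
    ∃ r : Fin 2 → ℂ, r ≠ 0 ∧ eval r f = 0 := by
  by_cases h : (dehom 0 f).coeff (d + 1) = 0
  · refine ⟨![1, 0], fun h => one_ne_zero (congrFun h 0), ?_⟩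
    rw [eq_sum_shiftedMonomial hf 0, Finset.sum_range_succ, h, C_0, zero_mul, add_zero, map_sum]
    refine Finset.sum_eq_zero fun k hk => ?_
    rw [Finset.mem_range] at hk
    simp [shiftedMonomial, show d + 1 - k ≠ 0 by omega]
  · obtain ⟨z, hz⟩ := IsAlgClosed.exists_root (dehom 0 f) (fun h0 => by
      have := Polynomial.coeff_eq_zero_of_degree_lt (p := dehom 0 f) (n := d + 1)
        (by rw [h0]; exact_mod_cast Nat.succ_pos d)
      exact h this)
    rw [Polynomial.IsRoot, eval_dehom] at hz
    exact ⟨_, fun h => one_ne_zero (congrFun h 1), hz⟩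

/-- Every binary form over `ℂ` is a product of linear forms. -/
theorem exists_eq_prod_perp {d : ℕ} {f : MvPolynomial (Fin 2) ℂ} (hf : f.IsHomogeneous d) :
    ∃ (c : ℂ) (r : Fin d → Fin 2 → ℂ), (∀ i, r i ≠ 0) ∧ f = C c * ∏ i, perp (r i) := by
  induction d generalizing f with
  | zero =>
    refine ⟨coeff 0 f, fun _ => 0, fun i => i.elim0, ?_⟩
    rw [← totalDegree_zero_iff_isHomogeneous, totalDegree_eq_zero_iff_eq_C] at hf
    simpa using hf
  | succ d ih =>
    obtain ⟨r, hr, h⟩ := exists_root hf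
    obtain ⟨g, hg, rfl⟩ := exists_eq_perp_mul hf hr h
    obtain ⟨c, s, hs, rfl⟩ := ih hg
    refine ⟨c, Fin.cons r s, fun i => Fin.cases (by simpa) (by simpa) i, ?_⟩
    rw [Fin.prod_univ_succ]
    simp
    ring

/-- A binary form vanishing at distinct points of the projective line is divisible by the product
of the corresponding linear forms. -/
theorem exists_eq_prod_perp_mul {k d : ℕ} {f : MvPolynomial (Fin 2) ℂ}
    (hf : f.IsHomogeneous (k + d)) {r : Fin k → Fin 2 → ℂ} (hr : ∀ i, r i ≠ 0)
    (hdet : ∀ i j, i ≠ j → det₂ (r i) (r j) ≠ 0) (h : ∀ i, eval (r i) f = 0) :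
    ∃ g : MvPolynomial (Fin 2) ℂ, g.IsHomogeneous d ∧ f = (∏ i, perp (r i)) * g := by
  induction k generalizing f with
  | zero => exact ⟨f, by simpa using hf, by simp⟩
  | succ k ih =>
    rw [show k + 1 + d = k + d + 1 by omega] at hf
    obtain ⟨g, hg, rfl⟩ := exists_eq_perp_mul hf (hr 0) (h 0)
    obtain ⟨g', hg', rfl⟩ := ih hg (r := fun i => r i.succ) (fun i => hr _)
      (fun i j hij => hdet _ _ fun h => hij (Fin.succ_injective _ h)) (fun i => by
        have := h i.succ
        rw [map_mul, eval_perp, mul_eq_zero] at this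
        exact this.resolve_left (hdet _ _ (Fin.succ_ne_zero i).symm))
    exact ⟨g', hg', by rw [Fin.prod_univ_succ, mul_assoc]⟩

end BinaryForms

/-! ### The Bombieri–Weyl form -/

section BombieriWeyl

open MvPolynomial

/-- The power `(r 0 X 0 + r 1 X 1)^d` of a linear form. -/
noncomputable def powForm (d : ℕ) (r : Fin 2 → ℂ) : BinaryForm d :=
  ⟨(C (r 0) * X 0 + C (r 1) * X 1) ^ d, by
    have h : (C (r 0) * X 0 + C (r 1) * X 1 : MvPolynomial (Fin 2) ℂ).IsHomogeneous 1 :=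
      (isHomogeneous_C_mul_X _ _).add (isHomogeneous_C_mul_X _ _)
    simpa using h.pow d⟩

theorem bombieriWeyl_comm (d : ℕ) (f g : BinaryForm d) :
    bombieriWeyl d f g = bombieriWeyl d g f := by
  simp_rw [bombieriWeyl_apply, mul_comm]

theorem bombieriWeyl_surjective (d : ℕ) : Function.Surjective (bombieriWeyl d) :=
  (LinearMap.injective_iff_surjective_of_finrank_eq_finrank
    (Subspace.dual_finrank_eq (K := ℂ) (V := BinaryForm d)).symm).mp (bombieriWeyl_injective d)

theorem exists_bombieriWeyl_ne_zero {d : ℕ} {f : BinaryForm d} (hf : f ≠ 0) :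
    ∃ g, bombieriWeyl d f g ≠ 0 := by
  by_contra! h
  exact hf (bombieriWeyl_injective d (by ext g; simp [h]))

theorem monomial_exponent_eq {m m' : ℕ × ℕ} :
    (Finsupp.single 0 m.1 + Finsupp.single 1 m.2 : Fin 2 →₀ ℕ) =
      Finsupp.single 0 m'.1 + Finsupp.single 1 m'.2 ↔ m = m' := by
  constructor
  · intro h
    have h0 := DFunLike.congr_fun h 0
    have h1 := DFunLike.congr_fun h 1
    simp at h0 h1
    exact Prod.ext h0 h1
  · rintro rfl
    rfl

theorem monomial_pair (a b : ℕ) (c : ℂ) :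
    monomial (Finsupp.single 0 a + Finsupp.single 1 b : Fin 2 →₀ ℕ) c =
      C c * (X 0 ^ a * X 1 ^ b) := by
  rw [X_pow_eq_monomial, X_pow_eq_monomial, monomial_mul, C_mul_monomial]
  simp

theorem binaryForm_eq_sum {d : ℕ} (f : BinaryForm d) : (f : MvPolynomial (Fin 2) ℂ) =
    ∑ m ∈ Finset.HasAntidiagonal.antidiagonal d,
      C (binaryCoeff d m f) * (X 0 ^ m.1 * X 1 ^ m.2) := by
  simp_rw [← monomial_pair]
  apply MvPolynomial.ext
  intro s
  obtain ⟨m₀, rfl⟩ : ∃ m : ℕ × ℕ, s = Finsupp.single 0 m.1 + Finsupp.single 1 m.2 :=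
    ⟨(s 0, s 1), by ext i; fin_cases i <;> simp⟩
  rw [coeff_sum]
  simp_rw [coeff_monomial, monomial_exponent_eq]
  by_cases h : m₀ ∈ Finset.HasAntidiagonal.antidiagonal d
  · rw [Finset.sum_ite_eq_of_mem' _ _ _ h]
    rfl
  · rw [Finset.sum_ite_eq', if_neg h]
    refine ((mem_homogeneousSubmodule d _).mp f.2).coeff_eq_zero fun hd => h ?_
    rw [Finset.HasAntidiagonal.mem_antidiagonal, ← hd, Finsupp.degree_eq_sum, Fin.sum_univ_two]
    simp

theorem binaryCoeff_powForm {d : ℕ} (r : Fin 2 → ℂ) {m : ℕ × ℕ}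
    (hm : m ∈ Finset.HasAntidiagonal.antidiagonal d) :
    binaryCoeff d m (powForm d r) = d.choose m.1 * (r 0 ^ m.1 * r 1 ^ m.2) := by
  have h : (powForm d r : MvPolynomial (Fin 2) ℂ) = ∑ m ∈ Finset.HasAntidiagonal.antidiagonal d,
      monomial (Finsupp.single 0 m.1 + Finsupp.single 1 m.2)
        (d.choose m.1 * (r 0 ^ m.1 * r 1 ^ m.2)) := by
    refine ((Commute.all _ _).add_pow' d).trans ?_
    refine Finset.sum_congr rfl fun m _ => ?_
    rw [monomial_pair, nsmul_eq_mul]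
    simp only [map_mul, map_pow, map_natCast]
    ring
  change coeff _ (powForm d r : MvPolynomial (Fin 2) ℂ) = _
  rw [h, coeff_sum]
  simp_rw [coeff_monomial, monomial_exponent_eq]
  rw [Finset.sum_ite_eq_of_mem' _ _ _ hm]

/-- The Bombieri–Weyl form is the apolar pairing: against a power of a linear form it evaluates. -/
theorem bombieriWeyl_powForm (d : ℕ) (r : Fin 2 → ℂ) (f : BinaryForm d) :
    bombieriWeyl d (powForm d r) f = eval r (f : MvPolynomial (Fin 2) ℂ) := by
  rw [bombieriWeyl_apply, binaryForm_eq_sum f, map_sum]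
  refine Finset.sum_congr rfl fun m hm => ?_
  have hc : ((d.choose m.1 : ℂ)) ≠ 0 := Nat.cast_ne_zero.mpr
    (Nat.choose_pos (Finset.HasAntidiagonal.antidiagonal.fst_le hm)).ne'
  rw [binaryCoeff_powForm r hm]
  simp only [map_mul, map_pow, eval_C, eval_X]
  field_simp

/-- The product of two binary forms of degree `n`, as a bilinear map. -/
noncomputable def mulForm (n : ℕ) : BinaryForm n →ₗ[ℂ] BinaryForm n →ₗ[ℂ] BinaryForm (2 * n) :=
  LinearMap.mk₂ ℂ (fun f g => ⟨f * g, by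
    have := ((mem_homogeneousSubmodule n _).mp f.2).mul ((mem_homogeneousSubmodule n _).mp g.2)
    rwa [← two_mul] at this⟩)
    (fun f f' g => Subtype.ext (add_mul _ _ _))
    (fun c f g => Subtype.ext (smul_mul_assoc _ _ _))
    (fun f g g' => Subtype.ext (mul_add _ _ _))
    (fun c f g => Subtype.ext (mul_smul_comm _ _ _))

theorem coe_mulForm {n : ℕ} (f g : BinaryForm n) :
    (mulForm n f g : MvPolynomial (Fin 2) ℂ) = f * g := rfl

theorem mulForm_eq_zero_iff {n : ℕ} {f g : BinaryForm n} : mulForm n f g = 0 ↔ f = 0 ∨ g = 0 := by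
  simp_rw [← Submodule.coe_eq_zero, coe_mulForm, mul_eq_zero]

theorem mem_squares_iff {n : ℕ} {g : BinaryForm (2 * n)} :
    g ∈ squares n ↔ ∃ f, g = mulForm n f f := by
  simp_rw [squares, Set.mem_ofPred_eq, Subtype.ext_iff, coe_mulForm, sq]

end BombieriWeyl

/-! ### Truncated square roots of polynomials -/

section SquareRoot

open Polynomial

theorem exists_sqrt_one_add_X (n : ℕ) : ∃ B : ℂ[X], B.natDegree ≤ n ∧ B.coeff 0 = 1 ∧
    X ^ (n + 1) ∣ B ^ 2 - (1 + X) := by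
  induction n with
  | zero => exact ⟨1, by simp, by simp, ⟨-1, by ring⟩⟩
  | succ n ih =>
    obtain ⟨B, hdeg, h0, R, hR⟩ := ih
    refine ⟨B + C (-R.coeff 0 / 2) * X ^ (n + 1), ?_, by simp [h0], ?_⟩
    · exact natDegree_add_le_of_degree_le (hdeg.trans n.le_succ) (natDegree_C_mul_X_pow_le _ _)
    · have hX : X ∣ R + 2 * C (-R.coeff 0 / 2) * B + C (-R.coeff 0 / 2) ^ 2 * X ^ (n + 1) := by
        rw [X_dvd_iff]
        simp [mul_coeff_zero, h0]
        ring
      obtain ⟨T, hT⟩ := hX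
      exact ⟨T, by linear_combination hR + X ^ (n + 1) * hT⟩

/-- The Taylor polynomial of degree `n` of `√(1 + X)`. -/
noncomputable def sqrtOneAddX (n : ℕ) : ℂ[X] := (exists_sqrt_one_add_X n).choose

theorem natDegree_sqrtOneAddX_le (n : ℕ) : (sqrtOneAddX n).natDegree ≤ n :=
  (exists_sqrt_one_add_X n).choose_spec.1

theorem coeff_zero_sqrtOneAddX (n : ℕ) : (sqrtOneAddX n).coeff 0 = 1 :=
  (exists_sqrt_one_add_X n).choose_spec.2.1

theorem X_pow_dvd_sqrtOneAddX_sq_sub (n : ℕ) : X ^ (n + 1) ∣ sqrtOneAddX n ^ 2 - (1 + X) :=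
  (exists_sqrt_one_add_X n).choose_spec.2.2

/-- With `q₀` the constant term of `q`, the Taylor expansion of `q₀ ^ (n + 1) √(q / q₀)` in powers
of `(q - q₀) / q₀`, up to order `n`. The factor `q₀ ^ (n + 1)` clears all denominators, so that
this is a homogeneous polynomial map of degree `n + 1` in `q`. -/
noncomputable def truncSqrt (n : ℕ) (q : ℂ[X]) : ℂ[X] :=
  ∑ j ∈ Finset.range (n + 1),
    (((sqrtOneAddX n).coeff j * q.coeff 0 ^ (n + 1 - j)) • (q - C (q.coeff 0)) ^ j)

variable {n : ℕ} {q : ℂ[X]}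

theorem truncSqrt_eq_zero (h : q.coeff 0 = 0) : truncSqrt n q = 0 := by
  refine Finset.sum_eq_zero fun j hj => ?_
  rw [h, zero_pow (by have := Finset.mem_range.mp hj; omega), mul_zero, zero_smul]

theorem coeff_zero_truncSqrt (n : ℕ) (q : ℂ[X]) :
    (truncSqrt n q).coeff 0 = q.coeff 0 ^ (n + 1) := by
  rw [truncSqrt, finsetSum_coeff, Finset.sum_range_succ', Finset.sum_eq_zero]
  · simp [coeff_zero_sqrtOneAddX]
  · intro j _
    rw [coeff_smul, coeff_zero_eq_eval_zero ((q - C (q.coeff 0)) ^ (j + 1))]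
    simp [coeff_zero_eq_eval_zero]

theorem truncSqrt_eq_comp (h : q.coeff 0 ≠ 0) : truncSqrt n q =
    C (q.coeff 0 ^ (n + 1)) * (sqrtOneAddX n).comp (C (q.coeff 0)⁻¹ * (q - C (q.coeff 0))) := by
  conv_rhs => rw [(sqrtOneAddX n).as_sum_range_C_mul_X_pow'
    (Nat.lt_succ_of_le (natDegree_sqrtOneAddX_le n))]
  rw [truncSqrt, Polynomial.sum_comp, Finset.mul_sum]
  refine Finset.sum_congr rfl fun j hj => ?_
  have hj' : j ≤ n + 1 := by have := Finset.mem_range.mp hj; omega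
  have : q.coeff 0 ^ (n + 1) * (q.coeff 0)⁻¹ ^ j = q.coeff 0 ^ (n + 1 - j) := by
    rw [pow_sub₀ _ h hj', inv_pow]
  rw [← this, smul_eq_C_mul]
  simp only [mul_comp, C_comp, pow_comp, X_comp, C_mul, C_pow, mul_pow]
  ring

/-- Modulo `X ^ (n + 1)`, the square of the truncated square root is `q₀ ^ (2 n + 1) q`. -/
theorem X_pow_dvd_truncSqrt_sq_sub (n : ℕ) (q : ℂ[X]) :
    X ^ (n + 1) ∣ truncSqrt n q ^ 2 - C (q.coeff 0 ^ (2 * n + 1)) * q := by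
  by_cases h : q.coeff 0 = 0
  · simp [truncSqrt_eq_zero h, h]
  · obtain ⟨R, hR⟩ := X_pow_dvd_sqrtOneAddX_sq_sub n
    obtain ⟨u, hu⟩ : X ∣ q - C (q.coeff 0) := by simp [X_dvd_iff]
    have hc := congrArg (fun p : ℂ[X] => p.comp (C (q.coeff 0)⁻¹ * (q - C (q.coeff 0)))) hR
    simp only [sub_comp, pow_comp, add_comp, one_comp, X_comp, mul_comp] at hc
    have h1 : C (q.coeff 0 ^ (n + 1)) ^ 2 * (1 + C (q.coeff 0)⁻¹ * (q - C (q.coeff 0))) =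
        C (q.coeff 0 ^ (2 * n + 1)) * q := by
      have hinv : (C (q.coeff 0) * C (q.coeff 0)⁻¹ : ℂ[X]) = 1 := by
        rw [← C_mul, mul_inv_cancel₀ h, C_1]
      simp only [C_pow]
      linear_combination C (q.coeff 0) ^ (2 * n + 1) * (q - C (q.coeff 0)) * hinv
    refine ⟨C (q.coeff 0 ^ (n + 1)) ^ 2 * C (q.coeff 0)⁻¹ ^ (n + 1) * u ^ (n + 1) *
      R.comp (C (q.coeff 0)⁻¹ * (q - C (q.coeff 0))), ?_⟩
    rw [truncSqrt_eq_comp h, ← h1, mul_pow, ← mul_sub, hc, mul_pow _ (q - _), hu]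
    ring

theorem X_pow_dvd_truncSqrt_sub {q' : ℂ[X]} (h : X ^ (n + 1) ∣ q - q') :
    X ^ (n + 1) ∣ truncSqrt n q - truncSqrt n q' := by
  have h0 : q.coeff 0 = q'.coeff 0 := by
    have := X_dvd_iff.mp ((dvd_pow_self X n.succ_ne_zero).trans h)
    rwa [coeff_sub, sub_eq_zero] at this
  rw [truncSqrt, truncSqrt, ← Finset.sum_sub_distrib]
  refine Finset.dvd_sum fun j _ => ?_
  rw [h0, ← smul_sub, smul_eq_C_mul]
  refine Dvd.dvd.mul_left ((?_ : _ ∣ _).trans (sub_dvd_pow_sub_pow _ _ j)) _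
  simpa using h

/-- Modulo `X ^ (n + 1)`, the truncated square root recovers `f` from `f ^ 2`, up to a scalar. -/
theorem X_pow_dvd_truncSqrt_sq_sub_self (n : ℕ) (f : ℂ[X]) :
    X ^ (n + 1) ∣ truncSqrt n (f ^ 2) - C (f.coeff 0 ^ (2 * n + 1)) * f := by
  have hsq : (f ^ 2).coeff 0 = f.coeff 0 ^ 2 := by simp [coeff_zero_eq_eval_zero]
  by_cases h : f.coeff 0 = 0
  · simp [truncSqrt_eq_zero (n := n) (q := f ^ 2) (by rw [hsq, h]; simp), h]
  -- The difference of the two squares factors, and the sum of the roots is a unit at `0`.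
  · have hdvd := X_pow_dvd_truncSqrt_sq_sub n (f ^ 2)
    have hfac : truncSqrt n (f ^ 2) ^ 2 - C ((f ^ 2).coeff 0 ^ (2 * n + 1)) * f ^ 2 =
        (truncSqrt n (f ^ 2) + C (f.coeff 0 ^ (2 * n + 1)) * f) *
          (truncSqrt n (f ^ 2) - C (f.coeff 0 ^ (2 * n + 1)) * f) := by
      rw [hsq]
      simp only [C_pow]
      ring
    rw [hfac] at hdvd
    refine IsCoprime.dvd_of_dvd_mul_left (IsCoprime.pow_left ?_) hdvd
    rw [irreducible_X.coprime_iff_not_dvd, X_dvd_iff, coeff_add, coeff_zero_truncSqrt, hsq,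
      coeff_C_mul]
    have : (f.coeff 0 ^ 2) ^ (n + 1) + f.coeff 0 ^ (2 * n + 1) * f.coeff 0 =
        2 * f.coeff 0 ^ (2 * n + 2) := by ring
    rw [this]
    simp [h]

end SquareRoot

/-! ### Equations for the variety of squares -/

section Squares

open MvPolynomial

/-- The binary form of degree `d` whose dehomogenization at `(a, 1)` is the truncation of `q` at
degree `d`. -/
noncomputable def rehom (d : ℕ) (a : ℂ) : Polynomial ℂ →ₗ[ℂ] BinaryForm d :=
  ∑ k : Fin (d + 1), (Polynomial.lcoeff ℂ k).smulRight
    (⟨shiftedMonomial d a k, isHomogeneous_shiftedMonomial a (Nat.lt_succ_iff.mp k.2)⟩ :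
      BinaryForm d)

/-- Dehomogenization, as a linear map on binary forms of fixed degree. -/
noncomputable def dehomForm (d : ℕ) (a : ℂ) : BinaryForm d →ₗ[ℂ] Polynomial ℂ :=
  (dehom a).toLinearMap ∘ₗ (homogeneousSubmodule (Fin 2) ℂ d).subtype

theorem dehomForm_apply {d : ℕ} (a : ℂ) (f : BinaryForm d) :
    dehomForm d a f = dehom a (f : MvPolynomial (Fin 2) ℂ) := rfl

theorem dehomForm_mulForm {n : ℕ} (a : ℂ) (f g : BinaryForm n) :
    dehomForm (2 * n) a (mulForm n f g) = dehomForm n a f * dehomForm n a g :=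
  map_mul (dehom a) _ _

theorem coe_rehom (d : ℕ) (a : ℂ) (q : Polynomial ℂ) : (rehom d a q : MvPolynomial (Fin 2) ℂ) =
    ∑ k ∈ Finset.range (d + 1), C (q.coeff k) * shiftedMonomial d a k := by
  rw [Finset.sum_range]
  simp [rehom, LinearMap.sum_apply, smul_eq_C_mul]

theorem rehom_dehomForm {d : ℕ} (a : ℂ) (f : BinaryForm d) : rehom d a (dehomForm d a f) = f :=
  Subtype.ext <| by rw [coe_rehom, dehomForm_apply, ← eq_sum_shiftedMonomial f.2 a]

theorem coeff_dehomForm_rehom {d k : ℕ} (a : ℂ) (q : Polynomial ℂ) (hk : k ≤ d) :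
    (dehomForm d a (rehom d a q)).coeff k = q.coeff k := by
  have hC : ∀ c : ℂ, dehom a (C c) = Polynomial.C c := fun c => by
    simp [dehom, ← Polynomial.algebraMap_eq]
  rw [dehomForm_apply, coe_rehom, map_sum]
  simp [hC, dehom_shiftedMonomial, hk]

theorem X_pow_dvd_dehomForm_rehom_sub {d : ℕ} (a : ℂ) (q : Polynomial ℂ) :
    Polynomial.X ^ (d + 1) ∣ dehomForm d a (rehom d a q) - q := by
  rw [Polynomial.X_pow_dvd_iff]
  intro k hk
  rw [Polynomial.coeff_sub, coeff_dehomForm_rehom a q (Nat.lt_succ_iff.mp hk), sub_self]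

theorem rehom_eq_of_dvd {d : ℕ} (a : ℂ) {q q' : Polynomial ℂ}
    (h : Polynomial.X ^ (d + 1) ∣ q - q') : rehom d a q = rehom d a q' := by
  rw [Polynomial.X_pow_dvd_iff] at h
  refine Subtype.ext ?_
  rw [coe_rehom, coe_rehom]
  refine Finset.sum_congr rfl fun k hk => ?_
  have := h k (Finset.mem_range.mp hk)
  rw [Polynomial.coeff_sub, sub_eq_zero] at this
  rw [this]

/-- Evaluation of a binary form at the point `(a, 1)`. -/
noncomputable def evalForm (d : ℕ) (a : ℂ) : Module.Dual ℂ (BinaryForm d) :=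
  Polynomial.lcoeff ℂ 0 ∘ₗ dehomForm d a

theorem evalForm_apply {d : ℕ} (a : ℂ) (f : BinaryForm d) :
    evalForm d a f = (dehomForm d a f).coeff 0 := rfl

theorem evalForm_mulForm {n : ℕ} (a : ℂ) (f : BinaryForm n) :
    evalForm (2 * n) a (mulForm n f f) = evalForm n a f ^ 2 := by
  rw [evalForm_apply, dehomForm_mulForm, Polynomial.mul_coeff_zero, sq]
  rfl

theorem exists_evalForm_ne_zero {d : ℕ} {f : BinaryForm d} (hf : f ≠ 0) :
    ∃ a, evalForm d a f ≠ 0 := by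
  by_contra! h
  refine hf (Subtype.ext (eq_zero_of_dehom_eq_zero f.2 (a := 0) (Polynomial.funext fun z => ?_)))
  rw [eval_dehom, add_zero, ← coeff_zero_dehom, Polynomial.eval_zero]
  exact h z

/-- A polynomial square root map `Sym^{2n} → Sym^n`, defined up to scalars on squares that do not
vanish at `(a, 1)`. -/
noncomputable def sqrtForm (n : ℕ) (a : ℂ) (h : BinaryForm (2 * n)) : BinaryForm n :=
  rehom n a (truncSqrt n (dehomForm (2 * n) a h))

/-- The map whose coordinates are equations for the variety of squares, away from the forms
vanishing at `(a, 1)`. -/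
noncomputable def squareEqn (n : ℕ) (a : ℂ) (h : BinaryForm (2 * n)) : BinaryForm (2 * n) :=
  evalForm (2 * n) a h ^ (2 * n + 1) • h - mulForm n (sqrtForm n a h) (sqrtForm n a h)

variable {n : ℕ} (a : ℂ)

theorem sqrtForm_mulForm (f : BinaryForm n) :
    sqrtForm n a (mulForm n f f) = evalForm n a f ^ (2 * n + 1) • f := by
  have h := rehom_eq_of_dvd a (X_pow_dvd_truncSqrt_sq_sub_self n (dehomForm n a f))
  rw [← Polynomial.smul_eq_C_mul, LinearMap.map_smul, rehom_dehomForm] at h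
  rw [sqrtForm, dehomForm_mulForm, ← sq]
  exact h

theorem squareEqn_mulForm (f : BinaryForm n) : squareEqn n a (mulForm n f f) = 0 := by
  rw [squareEqn, sqrtForm_mulForm, evalForm_mulForm]
  simp only [map_smul, LinearMap.smul_apply, smul_smul]
  rw [sub_eq_zero]
  ring_nf

theorem smul_mem_squares (c : ℂ) {h : BinaryForm (2 * n)} (hh : h ∈ squares n) :
    c • h ∈ squares n := by
  rw [mem_squares_iff] at hh ⊢
  obtain ⟨f, rfl⟩ := hh
  obtain ⟨z, hz⟩ := IsAlgClosed.exists_pow_nat_eq c two_pos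
  exact ⟨z • f, by simp [smul_smul, ← hz, sq]⟩

theorem mem_squares_of_squareEqn_eq_zero {h : BinaryForm (2 * n)} (h0 : evalForm (2 * n) a h ≠ 0)
    (hE : squareEqn n a h = 0) : h ∈ squares n := by
  have h1 := pow_ne_zero (2 * n + 1) h0
  rw [squareEqn, sub_eq_zero] at hE
  have : h = (evalForm (2 * n) a h ^ (2 * n + 1))⁻¹ •
      mulForm n (sqrtForm n a h) (sqrtForm n a h) := by
    rw [← hE, smul_smul, inv_mul_cancel₀ h1, one_smul]
  rw [this]
  exact smul_mem_squares _ (mem_squares_iff.mpr ⟨_, rfl⟩)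

theorem mem_squares_iff_forall_squareEqn {h : BinaryForm (2 * n)} :
    h ∈ squares n ↔ ∀ a, squareEqn n a h = 0 := by
  constructor
  · intro hh a
    obtain ⟨f, rfl⟩ := mem_squares_iff.mp hh
    exact squareEqn_mulForm a f
  · intro hE
    by_cases h0 : h = 0
    · exact mem_squares_iff.mpr ⟨0, by simp [h0]⟩
    · obtain ⟨a, ha⟩ := exists_evalForm_ne_zero h0
      exact mem_squares_of_squareEqn_eq_zero a ha (hE a)

/-- The first `n + 1` coordinates of the equations hold identically; only `n` equations remain. -/
theorem X_pow_dvd_dehomForm_squareEqn (h : BinaryForm (2 * n)) :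
    Polynomial.X ^ (n + 1) ∣ dehomForm (2 * n) a (squareEqn n a h) := by
  rw [squareEqn, map_sub, LinearMap.map_smul, dehomForm_mulForm, Polynomial.smul_eq_C_mul]
  have h1 := X_pow_dvd_truncSqrt_sq_sub n (dehomForm (2 * n) a h)
  have h2 := X_pow_dvd_dehomForm_rehom_sub (d := n) a (truncSqrt n (dehomForm (2 * n) a h))
  have h3 := (h2.mul_right (dehomForm n a (sqrtForm n a h) +
    truncSqrt n (dehomForm (2 * n) a h))).add h1
  rw [← dvd_neg]
  convert! h3 using 1
  rw [evalForm_apply, sqrtForm]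
  ring

/-- The equations are affine linear in the last `n` coordinates. -/
theorem squareEqn_add (h w : BinaryForm (2 * n))
    (hw : Polynomial.X ^ (n + 1) ∣ dehomForm (2 * n) a w) :
    squareEqn n a (h + w) = squareEqn n a h + evalForm (2 * n) a h ^ (2 * n + 1) • w := by
  have h0 : evalForm (2 * n) a (h + w) = evalForm (2 * n) a h := by
    rw [map_add, add_eq_left, evalForm_apply]
    exact Polynomial.X_pow_dvd_iff.mp hw 0 n.succ_pos
  have hS : sqrtForm n a (h + w) = sqrtForm n a h := by
    refine rehom_eq_of_dvd a (X_pow_dvd_truncSqrt_sub ?_)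
    rwa [map_add, add_sub_cancel_left]
  rw [squareEqn, squareEqn, h0, hS, smul_add]
  abel

theorem sqrtForm_mem_formMaps (n : ℕ) (a : ℂ) :
    sqrtForm n a ∈ formMaps (BinaryForm (2 * n)) (BinaryForm n) (n + 1) := by
  refine comp_mem_formMaps (Φ := fun h => truncSqrt n (dehomForm (2 * n) a h)) ?_ (rehom n a)
  have h1 : (fun h : BinaryForm (2 * n) => dehomForm (2 * n) a h -
      Polynomial.C ((dehomForm (2 * n) a h).coeff 0)) ∈
        formMaps (BinaryForm (2 * n)) (Polynomial ℂ) 1 :=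
    comp_mem_formMaps id_mem_formMaps (dehomForm (2 * n) a -
      (evalForm (2 * n) a).smulRight (1 : Polynomial ℂ)) |> fun h => by
        simpa [evalForm_apply, Polynomial.smul_eq_C_mul] using h
  have h2 : (fun h => truncSqrt n (dehomForm (2 * n) a h)) = ∑ j ∈ Finset.range (n + 1),
      fun h : BinaryForm (2 * n) => (((sqrtOneAddX n).coeff j •
        (evalForm (2 * n) a h ^ (n + 1 - j) • (1 : Polynomial ℂ))) * (dehomForm (2 * n) a h -
          Polynomial.C ((dehomForm (2 * n) a h).coeff 0)) ^ j) := by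
    funext h
    simp [truncSqrt, evalForm_apply, smul_smul]
  rw [h2]
  refine sum_mem fun j hj => ?_
  have h3 := mul_mem_formMaps (Submodule.smul_mem _ ((sqrtOneAddX n).coeff j)
    (smul_mem_formMaps ((isForm_dual (evalForm (2 * n) a)).pow (n + 1 - j)) (1 : Polynomial ℂ)))
    (pow_mem_formMaps h1 j)
  have hd : 1 * (n + 1 - j) + 1 * j = n + 1 := by have := Finset.mem_range.mp hj; omega
  rw [hd] at h3
  exact h3

theorem squareEqn_mem_formMaps (n : ℕ) (a : ℂ) :
    squareEqn n a ∈ formMaps (BinaryForm (2 * n)) (BinaryForm (2 * n)) (2 * n + 2) := by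
  have h1 := bilin_mem_formMaps (sqrtForm_mem_formMaps n a) (sqrtForm_mem_formMaps n a) (mulForm n)
  have h2 := bilin_mem_formMaps (smul_mem_formMaps
    ((isForm_dual (evalForm (2 * n) a)).pow (2 * n + 1)) (1 : ℂ)) id_mem_formMaps
    (LinearMap.lsmul ℂ (BinaryForm (2 * n)))
  rw [show n + 1 + (n + 1) = 2 * n + 2 by ring] at h1
  rw [show 1 * (2 * n + 1) + 1 = 2 * n + 2 by ring] at h2
  convert! sub_mem h2 h1 using 1
  funext h
  simp [squareEqn]

theorem isForm_comp_squareEqn (a : ℂ) (l : Module.Dual ℂ (BinaryForm (2 * n))) :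
    IsForm (2 * n + 2) fun h => l (squareEqn n a h) :=
  isFormMap_of_mem (squareEqn_mem_formMaps n a) l

end Squares

/-! ### The projective variety of squares -/

section SquareVariety

variable {n : ℕ}

theorem mk_mem_projectivize_squares_iff {h : BinaryForm (2 * n)} (hh : h ≠ 0) :
    Projectivization.mk ℂ h hh ∈ projectivize (squares n) ↔ h ∈ squares n := by
  constructor
  · rintro ⟨v, hv, hvs, h⟩
    obtain ⟨c, rfl⟩ := (Projectivization.mk_eq_mk_iff' ℂ _ _ _ _).mp h
    exact smul_mem_squares c hvs
  · exact fun h => ⟨_, hh, h, rfl⟩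

theorem mem_projectivize_squares_iff {p : Projectivization ℂ (BinaryForm (2 * n))} :
    p ∈ projectivize (squares n) ↔ p.rep ∈ squares n := by
  rw [← mk_mem_projectivize_squares_iff p.rep_nonzero, p.mk_rep]

theorem isZariskiClosed_projectivize_squares (n : ℕ) :
    IsZariskiClosed (projectivize (squares n)) := by
  refine ⟨{F | ∃ (a : ℂ) (l : Module.Dual ℂ (BinaryForm (2 * n))),
    F = fun h => l (squareEqn n a h)}, ?_, ?_⟩
  · rintro _ ⟨a, l, rfl⟩
    exact ⟨_, isForm_comp_squareEqn a l⟩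
  · ext p
    rw [mem_projectivize_squares_iff, mem_squares_iff_forall_squareEqn]
    constructor
    · rintro h _ ⟨a, l, rfl⟩
      simp [h a]
    · intro h a
      rw [← Module.forall_dual_apply_eq_zero_iff ℂ]
      exact fun l => h _ ⟨a, l, rfl⟩

theorem mulForm_self_ne_zero {f : BinaryForm n} (hf : f ≠ 0) : mulForm n f f ≠ 0 := by
  simpa [mulForm_eq_zero_iff] using hf

theorem isFormMap_mulForm_self (n : ℕ) : IsFormMap 2 fun f : BinaryForm n => mulForm n f f :=
  isFormMap_of_mem (bilin_mem_formMaps id_mem_formMaps id_mem_formMaps (mulForm n))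

theorem exists_binaryForm_ne_zero (n : ℕ) : ∃ f : BinaryForm n, f ≠ 0 := by
  refine ⟨powForm n ![1, 0], fun h => ?_⟩
  have := congrArg (fun f : BinaryForm n =>
    MvPolynomial.eval (![1, 0] : Fin 2 → ℂ) (f : MvPolynomial (Fin 2) ℂ)) h
  simp [powForm] at this

theorem isZariskiIrreducible_projectivize_squares (n : ℕ) :
    IsZariskiIrreducible (projectivize (squares n)) := by
  constructor
  · obtain ⟨f, hf⟩ := exists_binaryForm_ne_zero n
    exact ⟨_, _, mulForm_self_ne_zero hf, mem_squares_iff.mpr ⟨f, rfl⟩, rfl⟩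
  · rintro _ _ ⟨S₁, hS₁, rfl⟩ ⟨S₂, hS₂, rfl⟩ hsub
    by_contra! hcon
    simp_rw [Set.not_subset] at hcon
    obtain ⟨⟨_, ⟨_, hv₁, hs₁, rfl⟩, h₁⟩, ⟨_, ⟨_, hv₂, hs₂, rfl⟩, h₂⟩⟩ := hcon
    obtain ⟨f₁, rfl⟩ := mem_squares_iff.mp hs₁
    obtain ⟨f₂, rfl⟩ := mem_squares_iff.mp hs₂
    simp only [Set.mem_ofPred_eq, not_forall] at h₁ h₂
    obtain ⟨F₁, hF₁, h₁⟩ := h₁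
    obtain ⟨F₂, hF₂, h₂⟩ := h₂
    obtain ⟨d₁, hd₁⟩ := hS₁ _ hF₁
    obtain ⟨d₂, hd₂⟩ := hS₂ _ hF₂
    rw [hd₁.rep_mk_eq_zero_iff] at h₁
    rw [hd₂.rep_mk_eq_zero_iff] at h₂
    -- The forms need not vanish at `0` when they have degree `0`; the evaluation at `(a, 1)` is used as
    -- a third form to keep `f` nonzero.
    have hne : f₁ ≠ 0 := by
      rintro rfl
      simp at hv₁
    obtain ⟨a, ha⟩ := exists_evalForm_ne_zero hne
    have hG₁ := hd₁.comp (isFormMap_mulForm_self n)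
    have hG₂ := hd₂.comp (isFormMap_mulForm_self n)
    obtain ⟨f₃, h₃, h₃'⟩ := hG₁.exists_ne_zero (isForm_dual (evalForm n a)) h₁ ha
    obtain ⟨f, hf, hf₂⟩ := (hG₁.mul (isForm_dual (evalForm n a))).exists_ne_zero hG₂
      (mul_ne_zero h₃ h₃') h₂
    obtain ⟨hf₁, hf₀⟩ := mul_ne_zero_iff.mp hf
    have hf0 : f ≠ 0 := by
      rintro rfl
      simp at hf₀
    have hmem : Projectivization.mk ℂ _ (mulForm_self_ne_zero hf0) ∈ projectivize (squares n) :=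
      ⟨_, _, mem_squares_iff.mpr ⟨f, rfl⟩, rfl⟩
    rcases hsub hmem with h | h
    · exact hf₁ ((hd₁.rep_mk_eq_zero_iff _ _).mp (h F₁ hF₁))
    · exact hf₂ ((hd₂.rep_mk_eq_zero_iff _ _).mp (h F₂ hF₂))

theorem isSmoothPoint_projectivize_squares {p : Projectivization ℂ (BinaryForm (2 * n))}
    (hp : p ∈ projectivize (squares n)) : IsSmoothPoint (projectivize (squares n)) p := by
  obtain ⟨a, ha⟩ := exists_evalForm_ne_zero p.rep_nonzero
  -- The equations are the coefficients of index `> n`; they are dual to the directions `w j`.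
  let l : Fin n → Module.Dual ℂ (BinaryForm (2 * n)) := fun i =>
    Polynomial.lcoeff ℂ (n + 1 + i) ∘ₗ dehomForm (2 * n) a
  let w : Fin n → BinaryForm (2 * n) := fun i => rehom (2 * n) a (Polynomial.X ^ (n + 1 + i : ℕ))
  have hl : ∀ i j, l i (w j) = if i = j then 1 else 0 := fun i j => by
    change (dehomForm (2 * n) a (w j)).coeff (n + 1 + i) = _
    rw [coeff_dehomForm_rehom a _ (by omega), Polynomial.coeff_X_pow]
    simp [Fin.ext_iff]
  have hw : ∀ j, Polynomial.X ^ (n + 1) ∣ dehomForm (2 * n) a (w j) := fun j => by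
    rw [Polynomial.X_pow_dvd_iff]
    intro k hk
    rw [coeff_dehomForm_rehom a _ (by omega), Polynomial.coeff_X_pow, if_neg (by omega)]
  have hderiv : ∀ i j, lineDeriv ℂ (fun h => l i (squareEqn n a h)) p.rep (w j) =
      if i = j then evalForm (2 * n) a p.rep ^ (2 * n + 1) else 0 := fun i j => by
    have h1 : ∀ t : ℂ, l i (squareEqn n a (p.rep + t • w j)) = l i (squareEqn n a p.rep) +
        t * (if i = j then evalForm (2 * n) a p.rep ^ (2 * n + 1) else 0) := fun t => by
      rw [squareEqn_add a _ _ (by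
        rw [LinearMap.map_smul, Polynomial.smul_eq_C_mul]
        exact (hw j).mul_left _)]
      simp only [map_add, LinearMap.map_smul, hl, smul_eq_mul]
      split_ifs <;> ring
    have h2 := ((hasDerivAt_id (0 : ℂ)).mul_const
      (if i = j then evalForm (2 * n) a p.rep ^ (2 * n + 1) else 0)).const_add
        (l i (squareEqn n a p.rep))
    simp only [id, one_mul] at h2
    simp_rw [← h1] at h2
    exact h2.deriv
  refine ⟨hp, n, fun i h => l i (squareEqn n a h), {q | ∀ F ∈ ({fun h => evalForm (2 * n) a h} :
    Set (BinaryForm (2 * n) → ℂ)), F q.rep = 0}, fun i => ⟨_, isForm_comp_squareEqn a _⟩, ?_,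
    ⟨_, ?_, rfl⟩, ?_, ?_⟩
  · rw [Fintype.linearIndependent_iff]
    intro c hc i
    have := congrFun hc (w i)
    simp only [Finset.sum_apply, Pi.smul_apply, hderiv, smul_eq_mul, Pi.zero_apply] at this
    simpa [ha] using this
  · rintro _ rfl
    exact ⟨1, isForm_dual _⟩
  · exact fun h => ha (h _ rfl)
  · intro q hq
    have hq' : evalForm (2 * n) a q.rep ≠ 0 := fun h => hq (by rintro _ rfl; exact h)
    rw [mem_projectivize_squares_iff]
    constructor
    · intro h i
      dsimp only
      rw [mem_squares_iff_forall_squareEqn.mp h a, map_zero]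
    · intro h
      refine mem_squares_of_squareEqn_eq_zero a hq' ?_
      rw [← rehom_dehomForm a (squareEqn n a q.rep), ← map_zero (rehom (2 * n) a)]
      refine rehom_eq_of_dvd a ?_
      rw [sub_zero, Polynomial.X_pow_dvd_iff]
      intro k hk
      by_cases hkn : k < n + 1
      · exact Polynomial.X_pow_dvd_iff.mp (X_pow_dvd_dehomForm_squareEqn a q.rep) k hkn
      · have := h ⟨k - (n + 1), by omega⟩
        change (dehomForm (2 * n) a (squareEqn n a q.rep)).coeff (n + 1 + (k - (n + 1))) = 0 at this
        rwa [Nat.add_sub_cancel' (by omega)] at this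

theorem isSmoothProjectiveVariety_projectivize_squares (n : ℕ) :
    IsSmoothProjectiveVariety (projectivize (squares n)) :=
  ⟨isZariskiClosed_projectivize_squares n, isZariskiIrreducible_projectivize_squares n,
    fun _ => isSmoothPoint_projectivize_squares⟩

theorem mulForm_self_eq_smul_iff {f g : BinaryForm n} :
    (∃ c : ℂ, c • mulForm n f f = mulForm n g g) ↔ ∃ c : ℂ, c • f = g := by
  constructor
  · rintro ⟨c, hc⟩
    obtain ⟨z, hz⟩ := IsAlgClosed.exists_pow_nat_eq c two_pos
    have h : ((z • f : BinaryForm n) : MvPolynomial (Fin 2) ℂ) ^ 2 =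
        (g : MvPolynomial (Fin 2) ℂ) ^ 2 := by
      have := congrArg (Subtype.val) hc
      rw [Submodule.coe_smul, coe_mulForm, coe_mulForm] at this
      rw [Submodule.coe_smul, sq (g : MvPolynomial (Fin 2) ℂ), ← this, smul_pow, hz, sq]
    rcases sq_eq_sq_iff_eq_or_eq_neg.mp h with h | h
    · exact ⟨z, Subtype.ext h⟩
    · exact ⟨-z, Subtype.ext (by rw [Submodule.coe_smul, neg_smul, ← Submodule.coe_smul, h, neg_neg])⟩
  · rintro ⟨c, rfl⟩
    exact ⟨c * c, by simp [smul_smul]⟩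

/-- Coordinates on `Sym^n`: the coefficients of the dehomogenization. -/
noncomputable def binaryFormEquiv (n : ℕ) : BinaryForm n ≃ₗ[ℂ] (Fin (n + 1) → ℂ) :=
  LinearEquiv.ofBijective (LinearMap.pi fun i : Fin (n + 1) =>
    Polynomial.lcoeff ℂ (i : ℕ) ∘ₗ dehomForm n 0) <| by
      constructor
      · rw [← LinearMap.ker_eq_bot, LinearMap.ker_eq_bot']
        intro f hf
        rw [← rehom_dehomForm 0 f, ← map_zero (rehom n 0)]
        refine rehom_eq_of_dvd 0 ?_
        rw [sub_zero, Polynomial.X_pow_dvd_iff]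
        exact fun k hk => congrFun hf ⟨k, hk⟩
      · intro x
        refine ⟨rehom n 0 (∑ i : Fin (n + 1), Polynomial.C (x i) * Polynomial.X ^ (i : ℕ)), ?_⟩
        funext i
        change (dehomForm n 0 (rehom n 0 _)).coeff i = x i
        rw [coeff_dehomForm_rehom 0 _ (Nat.lt_succ_iff.mp i.2)]
        simp [Polynomial.coeff_X_pow, Fin.ext_iff.symm]

/-- The map `[x] ↦ [f_x ^ 2]` from `ℙ^n` onto the variety of squares. -/
noncomputable def squareMap (n : ℕ) (x : (Set.univ : Set (Projectivization ℂ (Fin (n + 1) → ℂ)))) :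
    projectivize (squares n) :=
  ⟨Projectivization.mk ℂ _ (mulForm_self_ne_zero
    ((binaryFormEquiv n).symm.map_ne_zero_iff.mpr x.1.rep_nonzero)),
    ⟨_, _, mem_squares_iff.mpr ⟨_, rfl⟩, rfl⟩⟩

theorem squareMap_bijective (n : ℕ) : Function.Bijective (squareMap n) := by
  constructor
  · intro x y h
    have h := congrArg Subtype.val h
    rw [squareMap, squareMap] at h
    dsimp only at h
    rw [Projectivization.mk_eq_mk_iff', mulForm_self_eq_smul_iff] at h
    obtain ⟨c, hc⟩ := h
    refine Subtype.ext ?_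
    rw [← x.1.mk_rep, ← y.1.mk_rep, Projectivization.mk_eq_mk_iff']
    exact ⟨c, (binaryFormEquiv n).symm.injective (by rw [map_smul, hc])⟩
  · rintro ⟨_, v, hv, hs, rfl⟩
    obtain ⟨f, rfl⟩ := mem_squares_iff.mp hs
    have hf : binaryFormEquiv n f ≠ 0 := by
      rw [(binaryFormEquiv n).map_ne_zero_iff]
      rintro rfl
      simp at hv
    refine ⟨⟨Projectivization.mk ℂ _ hf, trivial⟩, Subtype.ext ?_⟩
    obtain ⟨u, hu⟩ := Projectivization.exists_smul_eq_mk_rep ℂ _ hf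
    rw [squareMap]
    dsimp only
    rw [Projectivization.mk_eq_mk_iff', mulForm_self_eq_smul_iff]
    exact ⟨(u : ℂ), (binaryFormEquiv n).injective (by
      rw [map_smul, LinearEquiv.apply_symm_apply, ← hu, Units.smul_def])⟩

theorem isIsomorphicTo_projectivize_squares (n : ℕ) :
    IsIsomorphicTo (projectivize (squares n))
      (Set.univ : Set (Projectivization ℂ (Fin (n + 1) → ℂ))) := by
  refine ⟨(Equiv.ofBijective _ (squareMap_bijective n)).symm, ?_, ?_⟩
  · intro p
    obtain ⟨x, rfl⟩ := (squareMap_bijective n).2 p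
    obtain ⟨a, ha⟩ := exists_evalForm_ne_zero
      ((binaryFormEquiv n).symm.map_ne_zero_iff.mpr x.1.rep_nonzero)
    have key : ∀ y, ∃ c : ℂ, c ≠ 0 ∧ (squareMap n y).1.rep =
        c • mulForm n ((binaryFormEquiv n).symm y.1.rep) ((binaryFormEquiv n).symm y.1.rep) := by
      intro y
      obtain ⟨u, hu⟩ := Projectivization.exists_smul_eq_mk_rep ℂ _ (mulForm_self_ne_zero
        ((binaryFormEquiv n).symm.map_ne_zero_iff.mpr y.1.rep_nonzero))
      exact ⟨u, u.ne_zero, hu.symm⟩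
    have key' : ∀ y, ∃ c : ℂ, c ≠ 0 ∧ sqrtForm n a (squareMap n y).1.rep =
        (c * evalForm n a ((binaryFormEquiv n).symm y.1.rep)) ^ (2 * n + 1) •
          c • (binaryFormEquiv n).symm y.1.rep := by
      intro y
      obtain ⟨c, hc, hy⟩ := key y
      -- The scalar is absorbed into the square root.
      obtain ⟨z, rfl⟩ := IsAlgClosed.exists_pow_nat_eq c two_pos
      have hz : z ≠ 0 := by
        rintro rfl
        simp at hc
      have h := sqrtForm_mulForm a (z • (binaryFormEquiv n).symm y.1.rep)
      refine ⟨z, hz, ?_⟩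
      rw [hy]
      simpa [smul_smul, sq] using h
    refine ⟨n + 1, fun h => binaryFormEquiv n (sqrtForm n a h), isFormMap_of_mem
      (comp_mem_formMaps (sqrtForm_mem_formMaps n a) (binaryFormEquiv n).toLinearMap), ?_, ?_⟩
    · obtain ⟨c, hc, hx⟩ := key' x
      dsimp only
      rw [hx]
      simpa [hc, ha] using x.1.rep_nonzero
    · intro q hq
      obtain ⟨y, rfl⟩ := (squareMap_bijective n).2 q
      obtain ⟨c, hc, hy⟩ := key' y
      rw [Equiv.ofBijective_symm_apply_apply]
      conv_lhs => rw [← y.1.mk_rep]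
      symm
      rw [Projectivization.mk_eq_mk_iff']
      refine ⟨(c * evalForm n a ((binaryFormEquiv n).symm y.1.rep)) ^ (2 * n + 1) * c, ?_⟩
      dsimp only
      rw [hy, smul_smul, map_smul, LinearEquiv.apply_symm_apply]
  · intro x
    refine ⟨2, fun y => mulForm n ((binaryFormEquiv n).symm y) ((binaryFormEquiv n).symm y),
      isFormMap_of_mem (bilin_mem_formMaps
        (comp_mem_formMaps id_mem_formMaps (binaryFormEquiv n).symm.toLinearMap)
        (comp_mem_formMaps id_mem_formMaps (binaryFormEquiv n).symm.toLinearMap) (mulForm n)),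
      mulForm_self_ne_zero ((binaryFormEquiv n).symm.map_ne_zero_iff.mpr x.1.rep_nonzero), ?_⟩
    intro q hq
    rfl

end SquareVariety

/-! ### Apolarity and sums of powers -/

section Apolarity

open MvPolynomial Filter Topology

variable {n : ℕ}

/-- `g ∈ Sym^n` is apolar to `p ∈ Sym^{2n}` if it lies in the kernel of the catalecticant (Hankel)
form `(g, m) ↦ Q(p, g m)` of `p`. -/
def Apolar (p : BinaryForm (2 * n)) (g : BinaryForm n) : Prop :=
  ∀ m, bombieriWeyl (2 * n) p (mulForm n g m) = 0

/-- The basis of `Sym^n` given by the coordinates `binaryFormEquiv n`. -/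
noncomputable def binaryFormBasis (n : ℕ) : Module.Basis (Fin (n + 1)) ℂ (BinaryForm n) :=
  Module.Basis.ofEquivFun (binaryFormEquiv n)

/-- The catalecticant (Hankel) matrix of a binary form of even degree. -/
noncomputable def catalecticant (p : BinaryForm (2 * n)) : Matrix (Fin (n + 1)) (Fin (n + 1)) ℂ :=
  Matrix.of fun i j =>
    bombieriWeyl (2 * n) p (mulForm n (binaryFormBasis n i) (binaryFormBasis n j))

theorem mulForm_comm (f g : BinaryForm n) : mulForm n f g = mulForm n g f :=
  Subtype.ext (mul_comm _ _)

theorem apolar_iff_basis {p : BinaryForm (2 * n)} {g : BinaryForm n} :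
    Apolar p g ↔ ∀ i, bombieriWeyl (2 * n) p (mulForm n g (binaryFormBasis n i)) = 0 := by
  refine ⟨fun h i => h _, fun h m => ?_⟩
  rw [← (binaryFormBasis n).sum_repr m, map_sum, map_sum]
  simp only [LinearMap.map_smul, h, smul_zero, Finset.sum_const_zero]

theorem isForm_det_catalecticant (n : ℕ) :
    IsForm (n + 1) fun p : BinaryForm (2 * n) => (catalecticant p).det :=
  IsForm.det fun i j => isForm_dual ((bombieriWeyl (2 * n)).flip
    (mulForm n (binaryFormBasis n i) (binaryFormBasis n j)))

theorem det_catalecticant_eq_zero_iff {p : BinaryForm (2 * n)} :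
    (catalecticant p).det = 0 ↔ ∃ g, g ≠ 0 ∧ Apolar p g := by
  have key : ∀ v i, (catalecticant p).mulVec v i = bombieriWeyl (2 * n) p
      (mulForm n ((binaryFormBasis n).equivFun.symm v) (binaryFormBasis n i)) := fun v i => by
    rw [Module.Basis.equivFun_symm_apply]
    simp [Matrix.mulVec, dotProduct, catalecticant, mulForm_comm (binaryFormBasis n i), mul_comm]
  rw [← Matrix.exists_mulVec_eq_zero_iff]
  constructor
  · rintro ⟨v, hv, h⟩
    refine ⟨(binaryFormBasis n).equivFun.symm v, (LinearEquiv.map_ne_zero_iff _).mpr hv, apolar_iff_basis.mpr fun i => ?_⟩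
    rw [← key, h]
    rfl
  · rintro ⟨g, hg, h⟩
    refine ⟨(binaryFormBasis n).equivFun g, (LinearEquiv.map_ne_zero_iff _).mpr hg, ?_⟩
    funext i
    rw [key, LinearEquiv.symm_apply_apply, h]
    rfl

/-- The product of the linear forms vanishing at given points. -/
noncomputable def rootForm (r : Fin n → Fin 2 → ℂ) : BinaryForm n :=
  ⟨∏ i, perp (r i), by
    simpa using IsHomogeneous.prod Finset.univ (fun i => perp (r i)) (fun _ => 1)
      fun i _ => isHomogeneous_perp (r i)⟩

theorem coe_rootForm (r : Fin n → Fin 2 → ℂ) :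
    (rootForm r : MvPolynomial (Fin 2) ℂ) = ∏ i, perp (r i) := rfl

theorem eval_rootForm (r : Fin n → Fin 2 → ℂ) (s : Fin 2 → ℂ) :
    eval s (rootForm r : MvPolynomial (Fin 2) ℂ) = ∏ i, det₂ (r i) s := by
  simp [coe_rootForm, map_prod, eval_perp]

theorem rootForm_ne_zero {r : Fin n → Fin 2 → ℂ} (hr : ∀ i, r i ≠ 0) : rootForm r ≠ 0 := by
  rw [Ne, ← Submodule.coe_eq_zero, coe_rootForm]
  exact Finset.prod_ne_zero_iff.mpr fun i _ => perp_ne_zero (hr i)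

theorem exists_eq_smul_rootForm {g : BinaryForm n} (hg : g ≠ 0) :
    ∃ (c : ℂ) (r : Fin n → Fin 2 → ℂ), c ≠ 0 ∧ (∀ i, r i ≠ 0) ∧ g = c • rootForm r := by
  obtain ⟨c, r, hr, h⟩ := exists_eq_prod_perp g.2
  have hg' : g = c • rootForm r := Subtype.ext <| by
    rw [h, Submodule.coe_smul, smul_eq_C_mul, coe_rootForm]
  refine ⟨c, r, ?_, hr, hg'⟩
  rintro rfl
  exact hg (by simpa using hg')

theorem det₂_self (r : Fin 2 → ℂ) : det₂ r r = 0 := by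
  rw [det₂, mul_comm, sub_self]

theorem exists_det₂_ne_zero {r : Fin 2 → ℂ} (hr : r ≠ 0) : ∃ s, det₂ r s ≠ 0 := by
  by_contra! h
  apply perp_ne_zero hr
  exact MvPolynomial.funext fun s => by rw [eval_perp, h, map_zero]

theorem apolar_sum_powForm {k : ℕ} (c : Fin k → ℂ) (r : Fin k → Fin 2 → ℂ) {g : BinaryForm n}
    (hg : ∀ i, eval (r i) (g : MvPolynomial (Fin 2) ℂ) = 0) :
    Apolar (∑ i, c i • powForm (2 * n) (r i)) g := by
  intro m
  simp [LinearMap.sum_apply, bombieriWeyl_powForm, coe_mulForm, hg]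

/-- A form apolar to a product of distinct linear forms is a sum of powers of the linear forms
dual to its roots. -/
theorem exists_eq_sum_powForm {p : BinaryForm (2 * n)} {r : Fin n → Fin 2 → ℂ}
    (hr : ∀ i, r i ≠ 0) (hdet : ∀ i j, i ≠ j → det₂ (r i) (r j) ≠ 0)
    (hp : Apolar p (rootForm r)) : ∃ c : Fin n → ℂ, p = ∑ i, c i • powForm (2 * n) (r i) := by
  have h : bombieriWeyl (2 * n) p ∈ Submodule.span ℂ
      (Set.range fun i => bombieriWeyl (2 * n) (powForm (2 * n) (r i))) := by
    refine FiniteDimensional.mem_span_of_iInf_ker_le_ker fun h hh => ?_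
    simp only [Submodule.mem_iInf, LinearMap.mem_ker, bombieriWeyl_powForm] at hh
    obtain ⟨m, hm, hf⟩ := exists_eq_prod_perp_mul (k := n) (d := n)
      (by rw [← two_mul]; exact h.2) hr hdet hh
    rw [LinearMap.mem_ker, ← hp ⟨m, hm⟩]
    congr 1
    exact Subtype.ext hf
  obtain ⟨c, hc⟩ := Submodule.mem_span_range_iff_exists_fun ℂ |>.mp h
  exact ⟨c, bombieriWeyl_injective _ (by simp [← hc])⟩

/-- Weak continuity of a curve of binary forms may be tested on values. -/
theorem continuous_dual_of_continuous_eval {d : ℕ} {γ : ℂ → BinaryForm d}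
    (hγ : ∀ s, Continuous fun t => eval s (γ t : MvPolynomial (Fin 2) ℂ))
    (l : Module.Dual ℂ (BinaryForm d)) : Continuous fun t => l (γ t) := by
  have htop : Submodule.span ℂ (Set.range fun s => bombieriWeyl d (powForm d s)) = ⊤ := by
    rw [← Subspace.dualCoannihilator_dualAnnihilator_eq (W := Submodule.span ℂ _)]
    rw [Submodule.dualAnnihilator_eq_top_iff, eq_bot_iff]
    intro f hf
    rw [Submodule.mem_dualCoannihilator] at hf
    rw [Submodule.mem_bot]
    refine Subtype.ext (MvPolynomial.funext fun s => ?_)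
    rw [← bombieriWeyl_powForm, hf _ (Submodule.subset_span ⟨s, rfl⟩)]
    simp
  have hl : l ∈ Submodule.span ℂ (Set.range fun s => bombieriWeyl d (powForm d s)) :=
    htop ▸ Submodule.mem_top
  induction hl using Submodule.span_induction with
  | mem l h =>
    obtain ⟨s, rfl⟩ := h
    simpa [bombieriWeyl_powForm] using hγ s
  | zero => simpa using continuous_const
  | add l l' _ _ h h' => exact h.add h'
  | smul c l _ h => simpa using h.const_mul c

/-- An apolar pair deforms along with its second member. By Cramer's rule the deformation of the
first member exists for all values of the parameter. -/
theorem exists_apolar_curve {p : BinaryForm (2 * n)} {g : BinaryForm n} (hg : g ≠ 0)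
    (hp : Apolar p g) {γ : ℂ → BinaryForm n} (h0 : γ 0 = g)
    (hγ : ∀ l : Module.Dual ℂ (BinaryForm n), Continuous fun t => l (γ t)) :
    ∃ P : ℂ → BinaryForm (2 * n), P 0 = p ∧ (∀ t, Apolar (P t) (γ t)) ∧
      ∀ l : Module.Dual ℂ (BinaryForm (2 * n)), Continuous fun t => l (P t) := by
  let b := binaryFormBasis n
  obtain ⟨R, hR⟩ := LinearMap.exists_leftInverse_of_injective (mulForm n g) (by
    rw [LinearMap.ker_eq_bot']
    intro m hm
    exact (mulForm_eq_zero_iff.mp hm).resolve_left hg)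
  -- `b.coord i ∘ R` is dual to the products `g * b j`, and `q i` represents it.
  choose q hq using fun i => bombieriWeyl_surjective (2 * n) (b.coord i ∘ₗ R)
  let B : ℂ → Matrix (Fin (n + 1)) (Fin (n + 1)) ℂ := fun t =>
    Matrix.of fun i j => b.coord i (R (mulForm n (γ t) (b j)))
  have hγ' : ∀ (l : Module.Dual ℂ (BinaryForm (2 * n))) (m : BinaryForm n),
      Continuous fun t => l (mulForm n (γ t) m) := fun l m =>
    hγ (l ∘ₗ (mulForm n).flip m)
  have hB : Continuous B := continuous_matrix fun i j => hγ' (b.coord i ∘ₗ R) (b j)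
  have hB0 : B 0 = 1 := by
    ext i j
    have : R (mulForm n g (b j)) = b j := LinearMap.congr_fun hR (b j)
    simp [B, h0, this, Matrix.one_apply, Finsupp.single_apply, eq_comm]
  refine ⟨fun t => (B t).det • p - ∑ i, (∑ j, bombieriWeyl (2 * n) p (mulForm n (γ t) (b j)) *
    (B t).adjugate j i) • q i, ?_, ?_, ?_⟩
  · have : ∀ j, bombieriWeyl (2 * n) p (mulForm n (γ 0) (b j)) = 0 := fun j => by rw [h0, hp]
    simp [hB0, this]
  · intro t
    rw [apolar_iff_basis]
    intro k
    have hqk : ∀ i, bombieriWeyl (2 * n) (q i) (mulForm n (γ t) (b k)) = B t i k := fun i => by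
      rw [hq]
      rfl
    have hadj : ∀ j, ∑ i, (B t).adjugate j i * B t i k = if j = k then (B t).det else 0 :=
      fun j => by
        rw [← Matrix.mul_apply, Matrix.adjugate_mul]
        simp [Matrix.one_apply]
    have hb : binaryFormBasis n k = b k := rfl
    rw [hb, map_sub, LinearMap.map_smul, map_sum]
    simp only [LinearMap.sub_apply, LinearMap.smul_apply, LinearMap.sum_apply, map_smul, hqk,
      smul_eq_mul, Finset.sum_mul]
    rw [Finset.sum_comm]
    simp_rw [mul_assoc, ← Finset.mul_sum, hadj]
    simp [mul_comm]
  · intro l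
    simp only [map_sub, map_smul, map_sum, smul_eq_mul]
    refine (hB.matrix_det.mul_const _).sub (continuous_finsetSum _ fun i _ =>
      (continuous_finsetSum _ fun j _ => (hγ' _ _).mul ?_).mul_const _)
    exact hB.matrix_adjugate.matrix_elem j i

theorem Polynomial.eventually_eval_ne_zero {q : Polynomial ℂ} (hq : q ≠ 0) (x : ℂ) :
    ∀ᶠ t in 𝓝[≠] x, q.eval t ≠ 0 := by
  have h := (Polynomial.finite_setOfPred_isRoot hq).eventually_cofinite_notMem
  exact h.filter_mono (nhdsNE_le_cofinite x)

/-- The points of a tuple in `ℙ¹` become distinct after a suitable linear deformation. -/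
theorem eventually_distinct {r : Fin n → Fin 2 → ℂ} (hr : ∀ i, r i ≠ 0) :
    ∀ᶠ t in 𝓝[≠] (0 : ℂ), (∀ i, r i + t • ![1, (i : ℂ)] ≠ 0) ∧
      ∀ i j, i ≠ j → det₂ (r i + t • ![1, (i : ℂ)]) (r j + t • ![1, (j : ℂ)]) ≠ 0 := by
  refine Filter.Eventually.and ?_ ?_
  · rw [Filter.eventually_all]
    intro i
    have hc : Continuous fun t : ℂ => r i + t • ![1, (i : ℂ)] := by fun_prop
    refine Filter.Eventually.filter_mono nhdsWithin_le_nhds ?_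
    exact hc.continuousAt.eventually_ne (by simpa using hr i)
  · rw [Filter.eventually_all]
    intro i
    rw [Filter.eventually_all]
    intro j
    by_cases hij : i = j
    · simp [hij]
    -- The leading coefficient in `t` is the determinant `i - j` of the two directions.
    · let q : Polynomial ℂ := Polynomial.C ((i : ℂ) - j) * Polynomial.X ^ 2 +
        Polynomial.C (r i 1 + i * r j 0 - r i 0 * j - r j 1) * Polynomial.X +
        Polynomial.C (det₂ (r i) (r j))
      have hq : q ≠ 0 := by
        intro h
        have h2 := congrArg (fun p : Polynomial ℂ => p.coeff 2) h
        have : ((i : ℕ) : ℂ) = (j : ℕ) := by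
          simpa [q, Polynomial.coeff_X, Polynomial.coeff_C, Polynomial.coeff_X_pow,
            Polynomial.coeff_C_mul, -map_sub, sub_eq_zero] using h2
        exact hij (Fin.ext (by exact_mod_cast this))
      filter_upwards [Polynomial.eventually_eval_ne_zero hq 0] with t ht _
      convert! ht using 1
      simp [q, det₂]
      ring

theorem continuous_eval_rootForm (r : Fin n → Fin 2 → ℂ) (k : Fin n → Fin 2 → ℂ) (s : Fin 2 → ℂ) :
    Continuous fun t : ℂ => eval s (rootForm (fun i => r i + t • k i) : MvPolynomial (Fin 2) ℂ) := by
  simp_rw [eval_rootForm, det₂]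
  fun_prop

theorem eq_of_eventually_eq_punctured {f g : ℂ → ℂ} (hf : Continuous f) (hg : Continuous g)
    (h : ∀ᶠ t in 𝓝[≠] (0 : ℂ), f t = g t) : f 0 = g 0 :=
  tendsto_nhds_unique_of_eventuallyEq
    (hf.continuousAt.tendsto.mono_left nhdsWithin_le_nhds)
    (hg.continuousAt.tendsto.mono_left nhdsWithin_le_nhds) h

end Apolarity

/-! ### Differentials of forms vanishing on sums of powers -/

section Conormal

open MvPolynomial Filter Topology

variable {n : ℕ}

/-- Restriction of a polynomial in two variables to the line `t ↦ r + t m`. -/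
noncomputable def lineHom (r m : Fin 2 → ℂ) : MvPolynomial (Fin 2) ℂ →ₐ[ℂ] Polynomial ℂ :=
  aeval fun i => Polynomial.C (r i) + Polynomial.X * Polynomial.C (m i)

theorem eval_lineHom (r m : Fin 2 → ℂ) (f : MvPolynomial (Fin 2) ℂ) (t : ℂ) :
    (lineHom r m f).eval t = eval (r + t • m) f := by
  have := DFunLike.congr_fun (comp_aeval (R := ℂ) (fun i => Polynomial.C (r i) +
    Polynomial.X * Polynomial.C (m i)) (Polynomial.aeval t)) f
  have h : (fun i => Polynomial.aeval t (Polynomial.C (r i) + Polynomial.X * Polynomial.C (m i))) =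
      r + t • m := by
    funext i
    simp
    ring
  rw [h, AlgHom.comp_apply, MvPolynomial.aeval_eq_eval, Polynomial.coe_aeval_eq_eval] at this
  exact this

theorem coeff_zero_lineHom (r m : Fin 2 → ℂ) (f : MvPolynomial (Fin 2) ℂ) :
    (lineHom r m f).coeff 0 = eval r f := by
  rw [Polynomial.coeff_zero_eq_eval_zero, eval_lineHom, zero_smul, add_zero]

theorem hasDerivAt_eval_line (r m : Fin 2 → ℂ) (f : MvPolynomial (Fin 2) ℂ) :
    HasDerivAt (fun t : ℂ => eval (r + t • m) f) ((lineHom r m f).coeff 1) 0 := by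
  have := (lineHom r m f).hasDerivAt 0
  simp_rw [eval_lineHom] at this
  rwa [← Polynomial.coeff_zero_eq_eval_zero, Polynomial.coeff_derivative, zero_add, Nat.cast_zero,
    zero_add, mul_one] at this

/-- Euler's formula for a binary form. -/
theorem coeff_one_lineHom_self {d : ℕ} {f : MvPolynomial (Fin 2) ℂ} (hf : f.IsHomogeneous d)
    (r : Fin 2 → ℂ) : (lineHom r r f).coeff 1 = d * eval r f := by
  have : lineHom r r f = Polynomial.C (eval r f) * (1 + Polynomial.X) ^ d := by
    refine Polynomial.funext fun t => ?_
    have h : r + t • r = fun i => (1 + t) * r i := by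
      funext i
      simp
      ring
    rw [eval_lineHom, h, hf.eval_mul_left]
    simp [mul_comm]
  rw [this, Polynomial.coeff_C_mul, Polynomial.coeff_one_add_X_pow, Nat.choose_one_right, mul_comm]

/-- The tangent vector at `t = 0` to the curve `t ↦ (r + t m)^d` of powers of linear forms. -/
theorem exists_tangent_powForm (d : ℕ) (r m : Fin 2 → ℂ) : ∃ w : BinaryForm d,
    (∀ f : BinaryForm d, bombieriWeyl d f w = (lineHom r m f).coeff 1) ∧
    ∀ l : Module.Dual ℂ (BinaryForm d),
      HasDerivAt (fun t : ℂ => l (powForm d (r + t • m))) (l w) 0 := by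
  -- The velocity depends linearly on `f` and is therefore represented by some `w`.
  obtain ⟨w, hw⟩ := bombieriWeyl_surjective d (Polynomial.lcoeff ℂ 1 ∘ₗ
    (lineHom r m).toLinearMap ∘ₗ (homogeneousSubmodule (Fin 2) ℂ d).subtype)
  have h1 : ∀ f : BinaryForm d, bombieriWeyl d f w = (lineHom r m f).coeff 1 := fun f => by
    rw [bombieriWeyl_comm, hw]
    rfl
  refine ⟨w, h1, fun l => ?_⟩
  obtain ⟨f, rfl⟩ := bombieriWeyl_surjective d l
  simp_rw [bombieriWeyl_comm d f (powForm _ _), bombieriWeyl_powForm, h1]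
  exact hasDerivAt_eval_line r m f

/-- A binary form of degree `2 n` vanishing to second order at `n` distinct points is a multiple of
the square of the form of degree `n` with these roots. -/
theorem exists_eq_smul_rootForm_sq {r : Fin n → Fin 2 → ℂ} (hr : ∀ i, r i ≠ 0)
    (hdet : ∀ i j, i ≠ j → det₂ (r i) (r j) ≠ 0) {h : BinaryForm (2 * n)}
    (h0 : ∀ i, eval (r i) (h : MvPolynomial (Fin 2) ℂ) = 0)
    (h1 : ∀ i m, (lineHom (r i) m h).coeff 1 = 0) :
    ∃ c : ℂ, h = c • mulForm n (rootForm r) (rootForm r) := by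
  obtain ⟨h', hh', heq⟩ := exists_eq_prod_perp_mul (k := n) (d := n)
    (by rw [← two_mul]; exact h.2) hr hdet h0
  have hroot : ∀ i, eval (r i) h' = 0 := by
    intro i
    obtain ⟨m, hm⟩ := exists_det₂_ne_zero (hr i)
    have hperp : lineHom (r i) m (perp (r i)) = Polynomial.C (det₂ (r i) m) * Polynomial.X := by
      refine Polynomial.funext fun t => ?_
      rw [eval_lineHom, eval_perp]
      simp [det₂]
      ring
    have := h1 i m
    rw [heq, ← Finset.mul_prod_erase Finset.univ (fun i => perp (r i)) (Finset.mem_univ i), mul_assoc,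
      map_mul, hperp, mul_assoc, Polynomial.coeff_C_mul, Polynomial.coeff_X_mul,
      coeff_zero_lineHom, map_mul, map_prod] at this
    refine ((mul_eq_zero.mp ((mul_eq_zero.mp this).resolve_left hm)).resolve_left ?_)
    refine Finset.prod_ne_zero_iff.mpr fun j hj => ?_
    rw [eval_perp]
    exact hdet j i (Finset.ne_of_mem_erase hj)
  obtain ⟨h'', hh'', heq'⟩ := exists_eq_prod_perp_mul (k := n) (d := 0) hh' hr hdet hroot
  rw [← totalDegree_zero_iff_isHomogeneous, totalDegree_eq_zero_iff_eq_C] at hh''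
  refine ⟨coeff 0 h'', Subtype.ext ?_⟩
  rw [heq, heq', hh'', Submodule.coe_smul, coe_mulForm, coe_rootForm, smul_eq_C_mul, coeff_C]
  simp
  ring

variable {d : ℕ} {F : BinaryForm (2 * n) → ℂ}

/-- At a sum of powers of `n` distinct linear forms, the differential of a form vanishing on all such
sums is a multiple of the pairing with the square of the apolar form. -/
theorem exists_differential_eq_of_distinct (hn : 1 ≤ n) (hF : IsForm d F)
    (hvan : ∀ (c : Fin n → ℂ) (r : Fin n → Fin 2 → ℂ), (∀ i, r i ≠ 0) →
      F (∑ i, c i • powForm (2 * n) (r i)) = 0)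
    {c : Fin n → ℂ} (hc : ∀ i, c i ≠ 0) {r : Fin n → Fin 2 → ℂ} (hr : ∀ i, r i ≠ 0)
    (hdet : ∀ i j, i ≠ j → det₂ (r i) (r j) ≠ 0) :
    ∃ e : ℂ, hF.differential (∑ i, c i • powForm (2 * n) (r i)) =
      e • bombieriWeyl (2 * n) (mulForm n (rootForm r) (rootForm r)) := by
  obtain ⟨h, hh⟩ := bombieriWeyl_surjective (2 * n)
    (hF.differential (∑ i, c i • powForm (2 * n) (r i)))
  -- Moving a single summand `(r i)^{2n}` in the direction `m` stays in the zero locus of `F`.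
  have h1 : ∀ i m, (lineHom (r i) m h).coeff 1 = 0 := by
    intro i m
    obtain ⟨w, hw, hderiv⟩ := exists_tangent_powForm (2 * n) (r i) m
    let γ : ℂ → BinaryForm (2 * n) := fun t =>
      ∑ j, c j • powForm (2 * n) (Function.update r i (r i + t • m) j)
    have hγ0 : γ 0 = ∑ j, c j • powForm (2 * n) (r j) := by simp [γ]
    have hγ : ∀ l : Module.Dual ℂ (BinaryForm (2 * n)),
        HasDerivAt (fun t => l (γ t)) (l (c i • w)) 0 := by
      intro l
      have hsplit : ∀ t, l (γ t) = c i * l (powForm (2 * n) (r i + t • m)) +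
          ∑ j ∈ Finset.univ.erase i, c j * l (powForm (2 * n) (r j)) := by
        intro t
        rw [map_sum, ← Finset.add_sum_erase Finset.univ _ (Finset.mem_univ i)]
        congr 1
        · simp
        · refine Finset.sum_congr rfl fun j hj => ?_
          simp [Finset.ne_of_mem_erase hj]
      simp_rw [hsplit, map_smul, smul_eq_mul]
      exact ((hderiv l).const_mul _).add_const _
    have hzero : ∀ᶠ t in 𝓝 (0 : ℂ), F (γ t) = 0 := by
      have hcont : Continuous fun t : ℂ => r i + t • m := by fun_prop
      filter_upwards [hcont.continuousAt.eventually_ne (y := 0) (by simpa using hr i)] with t ht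
      refine hvan _ _ fun j => ?_
      by_cases hj : j = i
      · subst hj
        simpa using ht
      · simpa [hj] using hr j
    have hd := hF.hasDerivAt_comp hγ
    have := hd.unique ((hasDerivAt_const (0 : ℂ) (0 : ℂ)).congr_of_eventuallyEq hzero)
    rw [hγ0, ← hF.differential_apply, ← hh, map_smul, smul_eq_mul, hw] at this
    exact (mul_eq_zero.mp this).resolve_left (hc i)
  have h0 : ∀ i, eval (r i) (h : MvPolynomial (Fin 2) ℂ) = 0 := by
    intro i
    have := h1 i (r i)
    rw [coeff_one_lineHom_self h.2] at this
    refine (mul_eq_zero.mp this).resolve_left ?_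
    exact_mod_cast (by omega : 2 * n ≠ 0)
  obtain ⟨e, rfl⟩ := exists_eq_smul_rootForm_sq hr hdet h0 h1
  exact ⟨e, by rw [← hh, map_smul]⟩

/-- A form vanishing on all sums of `n` powers vanishes at every form `p` with a nonzero apolar form
`g` of degree `n`, and its differential at `p` is proportional to the pairing with `g ^ 2`. Both
conditions are closed, so it suffices to check them on the dense set of pairs `(p, g)` where `g` has
distinct roots and no coefficient of `p` vanishes. -/
theorem vanishing_and_differential_of_apolar (hn : 1 ≤ n) (hF : IsForm d F)
    (hvan : ∀ (c : Fin n → ℂ) (r : Fin n → Fin 2 → ℂ), (∀ i, r i ≠ 0) →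
      F (∑ i, c i • powForm (2 * n) (r i)) = 0)
    {p : BinaryForm (2 * n)} {g : BinaryForm n} (hg : g ≠ 0) (hp : Apolar p g) :
    F p = 0 ∧ ∀ v w, hF.differential p w * bombieriWeyl (2 * n) (mulForm n g g) v =
      hF.differential p v * bombieriWeyl (2 * n) (mulForm n g g) w := by
  have hdist : ∀ (c : Fin n → ℂ) (r : Fin n → Fin 2 → ℂ), (∀ i, r i ≠ 0) →
      (∀ i j, i ≠ j → det₂ (r i) (r j) ≠ 0) → ∀ v w,
      hF.differential (∑ i, c i • powForm (2 * n) (r i)) w *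
        bombieriWeyl (2 * n) (mulForm n (rootForm r) (rootForm r)) v =
      hF.differential (∑ i, c i • powForm (2 * n) (r i)) v *
        bombieriWeyl (2 * n) (mulForm n (rootForm r) (rootForm r)) w := by
    intro c r hr hdet v w
    -- Shifting all coefficients by a small `t ≠ 0` makes them nonzero.
    have hcont : ∀ l : Module.Dual ℂ (BinaryForm (2 * n)),
        Continuous fun t : ℂ => l (∑ i, (c i + t) • powForm (2 * n) (r i)) := fun l => by
      simp only [map_sum, map_smul, smul_eq_mul]
      fun_prop
    have := eq_of_eventually_eq_punctured
      ((hF.continuous_differential_comp hcont w).mul_const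
        (bombieriWeyl (2 * n) (mulForm n (rootForm r) (rootForm r)) v))
      ((hF.continuous_differential_comp hcont v).mul_const
        (bombieriWeyl (2 * n) (mulForm n (rootForm r) (rootForm r)) w)) (by
        have : ∀ᶠ t in 𝓝[≠] (0 : ℂ), ∀ i, c i + t ≠ 0 := by
          rw [Filter.eventually_all]
          intro i
          have := Polynomial.eventually_eval_ne_zero (Polynomial.X_add_C_ne_zero (c i)) 0
          filter_upwards [this] with t ht
          simpa [add_comm] using ht
        filter_upwards [this] with t ht
        obtain ⟨e, he⟩ := exists_differential_eq_of_distinct hn hF hvan ht hr hdet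
        rw [he]
        simp only [LinearMap.smul_apply, smul_eq_mul]
        ring)
    simpa using this
  obtain ⟨e, r, he, hr, rfl⟩ := exists_eq_smul_rootForm hg
  let r' : ℂ → Fin n → Fin 2 → ℂ := fun t i => r i + t • ![1, (i : ℂ)]
  have hr0 : r' 0 = r := funext fun i => by
    simp only [r', zero_smul, add_zero]
  have hγ : ∀ l : Module.Dual ℂ (BinaryForm n), Continuous fun t => l (e • rootForm (r' t)) :=
    fun l => by
      simp only [map_smul, smul_eq_mul]
      exact (continuous_dual_of_continuous_eval (continuous_eval_rootForm r _) l).const_mul e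
  obtain ⟨P, hP0, hPap, hPcont⟩ := exists_apolar_curve hg hp (γ := fun t => e • rootForm (r' t))
    (by rw [hr0]) hγ
  have hP : ∀ᶠ t in 𝓝[≠] (0 : ℂ), ∃ c : Fin n → ℂ,
      P t = ∑ i, c i • powForm (2 * n) (r' t i) := by
    filter_upwards [eventually_distinct hr] with t ht
    refine exists_eq_sum_powForm ht.1 ht.2 fun m => ?_
    have := hPap t m
    rw [map_smul, LinearMap.smul_apply, map_smul, smul_eq_mul] at this
    exact (mul_eq_zero.mp this).resolve_left he
  have hsq : ∀ v, Continuous fun t => bombieriWeyl (2 * n)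
      (mulForm n (e • rootForm (r' t)) (e • rootForm (r' t))) v := fun v =>
    (isFormMap_mulForm_self n ((bombieriWeyl (2 * n)).flip v)).continuous_comp hγ
  constructor
  · rw [← hP0]
    refine eq_of_eventually_eq_punctured (hF.continuous_comp hPcont) continuous_const ?_
    filter_upwards [hP, eventually_distinct hr] with t ⟨c, hc⟩ ht
    rw [hc]
    exact hvan c _ ht.1
  · intro v w
    have := eq_of_eventually_eq_punctured
      ((hF.continuous_differential_comp hPcont w).mul (hsq v))
      ((hF.continuous_differential_comp hPcont v).mul (hsq w)) (by
        filter_upwards [hP, eventually_distinct hr] with t ⟨c, hc⟩ ht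
        have := hdist c (r' t) ht.1 ht.2 v w
        simp only [Pi.mul_apply, hc, map_smul, LinearMap.smul_apply, smul_eq_mul]
        linear_combination e * e * this)
    simpa only [Pi.mul_apply, hP0, hr0] using this

end Conormal

/-! ### The secant variety of the rational normal curve -/

section Secant

open MvPolynomial

variable {n : ℕ}

/-- The union of the linear spans of `n`-tuples of points of the rational normal curve. -/
def secantPoints (n : ℕ) : Set (Projectivization ℂ (BinaryForm (2 * n))) :=
  {p | ∃ s : Fin n → Projectivization ℂ (BinaryForm (2 * n)),
    (∀ i, s i ∈ rationalNormalCurve (2 * n)) ∧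
      p ∈ Projectivization.Subspace.span (Set.range s)}

theorem secantVariety_eq_zariskiClosure (n : ℕ) :
    secantVariety n (rationalNormalCurve (2 * n)) = zariskiClosure (secantPoints n) := rfl

theorem exists_eq_linear (l : BinaryForm 1) : ∃ r : Fin 2 → ℂ,
    (l : MvPolynomial (Fin 2) ℂ) = C (r 0) * X 0 + C (r 1) * X 1 := by
  refine ⟨![binaryCoeff 1 (1, 0) l, binaryCoeff 1 (0, 1) l], ?_⟩
  rw [binaryForm_eq_sum l]
  simp [Finset.Nat.antidiagonal_succ, add_comm]

theorem linear_ne_zero {r : Fin 2 → ℂ} (hr : r ≠ 0) :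
    (C (r 0) * X 0 + C (r 1) * X 1 : MvPolynomial (Fin 2) ℂ) ≠ 0 := by
  have h : (![-r 1, r 0] : Fin 2 → ℂ) ≠ 0 := by
    intro h
    apply hr
    funext i
    fin_cases i
    · simpa using congrFun h 1
    · simpa using congrFun h 0
  simpa [perp] using perp_ne_zero h

theorem powForm_ne_zero (d : ℕ) {r : Fin 2 → ℂ} (hr : r ≠ 0) : powForm d r ≠ 0 := by
  rw [Ne, ← Submodule.coe_eq_zero]
  exact pow_ne_zero d (linear_ne_zero hr)

theorem mk_powForm_mem_rationalNormalCurve (d : ℕ) {r : Fin 2 → ℂ} (hr : r ≠ 0) :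
    Projectivization.mk ℂ (powForm d r) (powForm_ne_zero d hr) ∈ rationalNormalCurve d := by
  refine ⟨_, powForm_ne_zero d hr, ⟨powForm 1 r, powForm_ne_zero 1 hr, ?_⟩, rfl⟩
  simp [powForm]

theorem exists_rep_eq_smul_powForm {d : ℕ} {p : Projectivization ℂ (BinaryForm d)}
    (hp : p ∈ rationalNormalCurve d) :
    ∃ (c : ℂ) (r : Fin 2 → ℂ), r ≠ 0 ∧ p.rep = c • powForm d r := by
  obtain ⟨v, hv, ⟨l, hl, hvl⟩, rfl⟩ := hp
  obtain ⟨r, hr⟩ := exists_eq_linear l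
  obtain ⟨u, hu⟩ := Projectivization.exists_smul_eq_mk_rep ℂ v hv
  refine ⟨u, r, ?_, ?_⟩
  · rintro rfl
    exact hl (Subtype.ext (by simpa using hr))
  · rw [← hu, Units.smul_def]
    congr 1
    exact Subtype.ext (by rw [hvl, hr]; rfl)

theorem exists_apolar_of_mem_secantPoints {p : Projectivization ℂ (BinaryForm (2 * n))}
    (hp : p ∈ secantPoints n) : ∃ g : BinaryForm n, g ≠ 0 ∧ Apolar p.rep g := by
  obtain ⟨s, hs, hps⟩ := hp
  choose c r hr hrep using fun i => exists_rep_eq_smul_powForm (hs i)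
  refine ⟨rootForm r, rootForm_ne_zero hr, ?_⟩
  rw [mem_span_iff_rep_mem, ← Set.range_comp, Submodule.mem_span_range_iff_exists_fun] at hps
  obtain ⟨e, he⟩ := hps
  have : p.rep = ∑ i, (e i * c i) • powForm (2 * n) (r i) := by
    rw [← he]
    exact Finset.sum_congr rfl fun i _ => by rw [Function.comp_apply, hrep, smul_smul]
  rw [this]
  refine apolar_sum_powForm _ _ fun i => ?_
  rw [eval_rootForm]
  exact Finset.prod_eq_zero (Finset.mem_univ i) (det₂_self _)

theorem mk_sum_powForm_mem_secantPoints (c : Fin n → ℂ) {r : Fin n → Fin 2 → ℂ}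
    (hr : ∀ i, r i ≠ 0) (h : ∑ i, c i • powForm (2 * n) (r i) ≠ 0) :
    Projectivization.mk ℂ _ h ∈ secantPoints n := by
  refine ⟨fun i => Projectivization.mk ℂ _ (powForm_ne_zero (2 * n) (hr i)),
    fun i => mk_powForm_mem_rationalNormalCurve _ (hr i), ?_⟩
  rw [← Projectivization.Subspace.mem_submodule_iff]
  refine sum_mem fun i _ => Submodule.smul_mem _ _ ?_
  rw [Projectivization.Subspace.mem_submodule_iff _ (powForm_ne_zero _ (hr i))]
  exact Projectivization.Subspace.subset_span _ ⟨i, rfl⟩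

theorem apply_sum_powForm_eq_zero (hn : 1 ≤ n) {d : ℕ} {F : BinaryForm (2 * n) → ℂ}
    (hF : IsForm d F) (hvan : ∀ q ∈ secantPoints n, F q.rep = 0) (c : Fin n → ℂ)
    (r : Fin n → Fin 2 → ℂ) (hr : ∀ i, r i ≠ 0) : F (∑ i, c i • powForm (2 * n) (r i)) = 0 := by
  by_cases h : ∑ i, c i • powForm (2 * n) (r i) = 0
  -- A form of degree `0` need not vanish at the origin, so a point of the cone is needed.
  · have h1 : ∑ i, (Pi.single ⟨0, hn⟩ 1 : Fin n → ℂ) i • powForm (2 * n) (r i) =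
        powForm (2 * n) (r ⟨0, hn⟩) := by
      simp [Pi.single_apply]
    have h2 := mk_sum_powForm_mem_secantPoints (Pi.single ⟨0, hn⟩ 1) hr
      (h1 ▸ powForm_ne_zero _ (hr _))
    have h3 := (hF.rep_mk_eq_zero_iff _ _).mp (hvan _ h2)
    have h4 := hF.map_smul 0 (∑ i, (Pi.single ⟨0, hn⟩ 1 : Fin n → ℂ) i • powForm (2 * n) (r i))
    rw [h3, mul_zero, zero_smul] at h4
    rw [h, h4]
  · exact (hF.rep_mk_eq_zero_iff _ h).mp (hvan _ (mk_sum_powForm_mem_secantPoints c hr h))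

/-- The secant variety is the catalecticant hypersurface. -/
theorem mem_secantVariety_iff (hn : 1 ≤ n) {p : Projectivization ℂ (BinaryForm (2 * n))} :
    p ∈ secantVariety n (rationalNormalCurve (2 * n)) ↔
      ∃ g : BinaryForm n, g ≠ 0 ∧ Apolar p.rep g := by
  rw [secantVariety_eq_zariskiClosure]
  constructor
  · intro hp
    rw [← det_catalecticant_eq_zero_iff]
    exact hp _ _ (isForm_det_catalecticant n) fun q hq =>
      det_catalecticant_eq_zero_iff.mpr (exists_apolar_of_mem_secantPoints hq)
  · rintro ⟨g, hg, hp⟩ d F hF hvan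
    exact (vanishing_and_differential_of_apolar hn hF
      (apply_sum_powForm_eq_zero hn hF hvan) hg hp).1

/-- The conormal directions at a point of the secant variety with apolar form `g` are spanned by the
pairing with `g ^ 2`: the orthogonal complement of `g ^ 2` is contained in the tangent space. -/
theorem mem_embeddedTangentSpace_of_apolar (hn : 1 ≤ n)
    {p : Projectivization ℂ (BinaryForm (2 * n))} {g : BinaryForm n} (hg : g ≠ 0)
    (hp : Apolar p.rep g) {w : BinaryForm (2 * n)}
    (hw : bombieriWeyl (2 * n) (mulForm n g g) w = 0) :
    w ∈ embeddedTangentSpace (secantVariety n (rationalNormalCurve (2 * n))) p := by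
  intro d F hF hvan
  rw [secantVariety_eq_zariskiClosure, hF.vanishes_on_zariskiClosure_iff] at hvan
  obtain ⟨v, hv⟩ := exists_bombieriWeyl_ne_zero (mulForm_self_ne_zero hg)
  have := (vanishing_and_differential_of_apolar hn hF
      (apply_sum_powForm_eq_zero hn hF hvan) hg hp).2 v w
  rw [hw, mul_zero] at this
  exact (mul_eq_zero.mp this).resolve_right hv

end Secant

/-! ### Smooth points of the catalecticant hypersurface -/

section Smooth

open MvPolynomial Filter Topology

variable {n : ℕ}

/-- The catalecticant of a sum of powers factors as `Vᵀ diag(c) V`, with `V` a Vandermonde matrix. -/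
theorem det_catalecticant_sum_powForm (c : Fin (n + 1) → ℂ) (s : Fin (n + 1) → Fin 2 → ℂ) :
    (catalecticant (∑ k, c k • powForm (2 * n) (s k))).det = (∏ k, c k) *
      (Matrix.of fun k i => eval (s k) (binaryFormBasis n i : MvPolynomial (Fin 2) ℂ)).det ^ 2 := by
  have h : catalecticant (∑ k, c k • powForm (2 * n) (s k)) =
      (Matrix.of fun k i => eval (s k) (binaryFormBasis n i : MvPolynomial (Fin 2) ℂ)).transpose *
        (Matrix.diagonal c *
          Matrix.of fun k i => eval (s k) (binaryFormBasis n i : MvPolynomial (Fin 2) ℂ)) := by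
    ext i j
    simp only [catalecticant, Matrix.of_apply, map_sum, map_smul, LinearMap.sum_apply,
      LinearMap.smul_apply, bombieriWeyl_powForm, coe_mulForm, map_mul, smul_eq_mul,
      Matrix.mul_apply (M := Matrix.transpose _), Matrix.diagonal_mul, Matrix.transpose_apply]
    exact Finset.sum_congr rfl fun k _ => by ring
  rw [h, Matrix.det_mul, Matrix.det_mul, Matrix.det_transpose, Matrix.det_diagonal]
  ring

/-- The Vandermonde determinant of `n + 1` distinct points of `ℙ¹`. -/
theorem det_eval_ne_zero {r : Fin n → Fin 2 → ℂ} (hr : ∀ i, r i ≠ 0)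
    (hdet : ∀ i j, i ≠ j → det₂ (r i) (r j) ≠ 0) {s : Fin 2 → ℂ} (hs : ∀ i, det₂ (r i) s ≠ 0) :
    (Matrix.of fun k i => eval ((Fin.cons s r : Fin (n + 1) → Fin 2 → ℂ) k)
      (binaryFormBasis n i : MvPolynomial (Fin 2) ℂ)).det ≠ 0 := by
  intro h
  obtain ⟨v, hv, hMv⟩ := Matrix.exists_mulVec_eq_zero_iff.mpr h
  set f := (binaryFormBasis n).equivFun.symm v with hf
  have hf0 : f ≠ 0 := (LinearEquiv.map_ne_zero_iff _).mpr hv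
  have hev : ∀ k, eval ((Fin.cons s r : Fin (n + 1) → Fin 2 → ℂ) k)
      (f : MvPolynomial (Fin 2) ℂ) = 0 := by
    intro k
    have := congrFun hMv k
    rw [hf, Module.Basis.equivFun_symm_apply]
    simpa [Matrix.mulVec, dotProduct, mul_comm, smul_eq_C_mul, map_sum] using this
  obtain ⟨g, hg, heq⟩ := exists_eq_prod_perp_mul (k := n) (d := 0) f.2 hr hdet
    fun i => by simpa using hev i.succ
  rw [← totalDegree_zero_iff_isHomogeneous, totalDegree_eq_zero_iff_eq_C] at hg
  have h0 := hev 0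
  rw [Fin.cons_zero, heq, hg, map_mul, map_prod, eval_C] at h0
  have hc : coeff 0 g = 0 := by
    refine (mul_eq_zero.mp h0).resolve_left (Finset.prod_ne_zero_iff.mpr fun i _ => ?_)
    rw [eval_perp]
    exact hs i
  rw [hc, C_0] at hg
  exact hf0 (Subtype.ext (by rw [heq, hg, mul_zero]; rfl))

theorem exists_forall_det₂_ne_zero {r : Fin n → Fin 2 → ℂ} (hr : ∀ i, r i ≠ 0) :
    ∃ s, ∀ i, det₂ (r i) s ≠ 0 := by
  by_contra! h
  refine rootForm_ne_zero hr (Subtype.ext (MvPolynomial.funext fun s => ?_))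
  obtain ⟨i, hi⟩ := h s
  rw [eval_rootForm, Finset.prod_eq_zero (Finset.mem_univ i) hi]
  simp

/-- Adding one more power to a sum of `n` powers of distinct linear forms makes the catalecticant
nondegenerate to first order. -/
theorem exists_det_catalecticant_add_smul {r : Fin n → Fin 2 → ℂ} (hr : ∀ i, r i ≠ 0)
    (hdet : ∀ i j, i ≠ j → det₂ (r i) (r j) ≠ 0) {u : ℂ} (hu : u ≠ 0) :
    ∃ (w : BinaryForm (2 * n)) (e : ℂ), e ≠ 0 ∧ ∀ t : ℂ,
      (catalecticant (u • ∑ i, powForm (2 * n) (r i) + t • w)).det = t * e := by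
  obtain ⟨s, hs⟩ := exists_forall_det₂_ne_zero hr
  refine ⟨powForm (2 * n) s, u ^ n * _ ^ 2,
    mul_ne_zero (pow_ne_zero _ hu) (pow_ne_zero 2 (det_eval_ne_zero hr hdet hs)), fun t => ?_⟩
  have h := det_catalecticant_sum_powForm (Fin.cons t fun _ => u : Fin (n + 1) → ℂ)
    (Fin.cons s r : Fin (n + 1) → Fin 2 → ℂ)
  rw [Fin.sum_univ_succ, Fin.prod_univ_succ] at h
  simp only [Fin.cons_zero, Fin.cons_succ, Finset.prod_const, Finset.card_univ,
    Fintype.card_fin] at h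
  rw [Finset.smul_sum, add_comm (∑ i, u • powForm (2 * n) (r i)), h]
  ring

theorem sum_powForm_ne_zero (hn : 1 ≤ n) {r : Fin n → Fin 2 → ℂ} (hr : ∀ i, r i ≠ 0)
    (hdet : ∀ i j, i ≠ j → det₂ (r i) (r j) ≠ 0) : ∑ i, powForm (2 * n) (r i) ≠ 0 := by
  intro h
  -- Otherwise the determinant, a form of degree `n + 1 > 1`, would be linear on a line through `0`.
  obtain ⟨w, e, he, hdetw⟩ := exists_det_catalecticant_add_smul hr hdet one_ne_zero
  simp only [h, smul_zero, zero_add] at hdetw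
  have h1 := (isForm_det_catalecticant n).map_smul 2 w
  have h2 := hdetw 1
  rw [one_smul, one_mul] at h2
  rw [hdetw, h2] at h1
  have h3 : (2 : ℂ) = 2 ^ (n + 1) := mul_right_cancel₀ he h1
  have h4 : (2 : ℕ) = 2 ^ (n + 1) := by exact_mod_cast h3
  have h5 : 2 ^ 1 < 2 ^ (n + 1) := Nat.pow_lt_pow_right (by norm_num) (by omega)
  omega

/-- A sum of powers of `n` distinct linear forms is a smooth point of the secant variety, and the
tangent space there is annihilated by the pairing with the square of the apolar form. -/
theorem isSmoothPoint_sum_powForm (hn : 1 ≤ n) {r : Fin n → Fin 2 → ℂ} (hr : ∀ i, r i ≠ 0)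
    (hdet : ∀ i j, i ≠ j → det₂ (r i) (r j) ≠ 0) :
    ∃ p, IsSmoothPoint (secantVariety n (rationalNormalCurve (2 * n))) p ∧
      ∀ w ∈ embeddedTangentSpace (secantVariety n (rationalNormalCurve (2 * n))) p,
        bombieriWeyl (2 * n) (mulForm n (rootForm r) (rootForm r)) w = 0 := by
  let p := Projectivization.mk ℂ _ (sum_powForm_ne_zero hn hr hdet)
  obtain ⟨u, hu⟩ := Projectivization.exists_smul_eq_mk_rep ℂ _ (sum_powForm_ne_zero hn hr hdet)
  have hrep : p.rep = (u : ℂ) • ∑ i, powForm (2 * n) (r i) := hu.symm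
  have hap : Apolar p.rep (rootForm r) := by
    rw [hrep, Finset.smul_sum]
    refine apolar_sum_powForm _ _ fun i => ?_
    rw [eval_rootForm]
    exact Finset.prod_eq_zero (Finset.mem_univ i) (det₂_self _)
  have hp : p ∈ secantVariety n (rationalNormalCurve (2 * n)) :=
    (mem_secantVariety_iff hn).mpr ⟨_, rootForm_ne_zero hr, hap⟩
  have hD := isForm_det_catalecticant n
  obtain ⟨w₀, e, he, hw₀⟩ := exists_det_catalecticant_add_smul hr hdet u.ne_zero
  have hderiv : hD.differential p.rep w₀ = e := by
    have h1 := (hasDerivAt_id (0 : ℂ)).mul_const e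
    simp only [id, one_mul] at h1
    simp_rw [← hw₀, ← hrep] at h1
    exact h1.deriv
  have hvan : ∀ q ∈ secantVariety n (rationalNormalCurve (2 * n)), (catalecticant q.rep).det = 0 :=
    fun q hq => det_catalecticant_eq_zero_iff.mpr ((mem_secantVariety_iff hn).mp hq)
  -- The determinant is a global equation, so the exceptional closed set in the definition of a
  -- smooth point is empty: it is the zero locus of the constant form `1`.
  refine ⟨p, ⟨hp, 1, fun _ q => (catalecticant q).det, ∅, fun _ => ⟨_, hD⟩, ?_, ?_,
    Set.notMem_empty _, fun q _ => ?_⟩, fun w hw => ?_⟩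
  · rw [Fintype.linearIndependent_iff]
    intro c hc i
    have := congrFun hc w₀
    simp only [Finset.sum_apply, Pi.smul_apply, ← hD.differential_apply, hderiv, smul_eq_mul,
      Pi.zero_apply] at this
    rw [Subsingleton.elim i 0]
    simpa [he] using this
  · refine ⟨{fun _ => 1}, ?_, ?_⟩
    · rintro _ rfl
      exact ⟨0, isForm_const 1⟩
    · simp
  · rw [mem_secantVariety_iff hn, ← det_catalecticant_eq_zero_iff]
    simp
  · have h1 : hD.differential p.rep w = 0 := hw _ _ hD hvan
    have h2 := (vanishing_and_differential_of_apolar hn hD (apply_sum_powForm_eq_zero hn hD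
      fun q hq => hvan q (subset_zariskiClosure _ hq)) (rootForm_ne_zero hr) hap).2 w₀ w
    rw [h1, hderiv, zero_mul] at h2
    exact (mul_eq_zero.mp h2.symm).resolve_left he

end Smooth

/-! ### The dual variety -/

section Dual

open MvPolynomial Filter Topology

variable {n : ℕ}

theorem dualVariety_subset (hn : 1 ≤ n) :
    dualVariety (secantVariety n (rationalNormalCurve (2 * n))) ⊆
      Projectivization.map (bombieriWeyl (2 * n)) (bombieriWeyl_injective (2 * n)) ''
        projectivize (squares n) := by
  intro H hH
  let Q := LinearEquiv.ofBijective (bombieriWeyl (2 * n))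
    ⟨bombieriWeyl_injective _, bombieriWeyl_surjective _⟩
  have hsq : Q.symm H.rep ∈ squares n := by
    rw [mem_squares_iff_forall_squareEqn]
    intro a
    rw [← Module.forall_dual_apply_eq_zero_iff ℂ]
    intro l
    have hQ : IsFormMap 1 fun φ : Module.Dual ℂ (BinaryForm (2 * n)) => Q.symm φ :=
      fun l => isForm_dual (l ∘ₗ Q.symm.toLinearMap)
    refine hH _ _ ((isForm_comp_squareEqn a l).comp hQ) ?_
    rintro K ⟨p, hp, hK⟩
    obtain ⟨g, hg, hpg⟩ := (mem_secantVariety_iff hn).mp hp.1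
    obtain ⟨v, hv⟩ := exists_bombieriWeyl_ne_zero (mulForm_self_ne_zero hg)
    have hrep : K.rep = Q ((K.rep v / bombieriWeyl (2 * n) (mulForm n g g) v) • mulForm n g g) := by
      ext w
      -- `w - (Q(g², w) / Q(g², v)) v` is orthogonal to `g²`, hence tangent.
      have h1 := hK _ (mem_embeddedTangentSpace_of_apolar hn hg hpg
        (w := w - (bombieriWeyl (2 * n) (mulForm n g g) w /
          bombieriWeyl (2 * n) (mulForm n g g) v) • v) (by
            rw [map_sub, map_smul, smul_eq_mul, div_mul_cancel₀ _ hv, sub_self]))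
      rw [map_sub, map_smul, smul_eq_mul, sub_eq_zero] at h1
      rw [map_smul, LinearMap.smul_apply, h1]
      change _ = _ • bombieriWeyl (2 * n) (mulForm n g g) w
      rw [smul_eq_mul]
      ring
    have hmem : Q.symm K.rep ∈ squares n := by
      rw [hrep, Q.symm_apply_apply]
      exact smul_mem_squares _ (mem_squares_iff.mpr ⟨g, rfl⟩)
    rw [mem_squares_iff_forall_squareEqn.mp hmem a, map_zero]
  have h0 : Q.symm H.rep ≠ 0 := Q.symm.map_ne_zero_iff.mpr H.rep_nonzero
  refine ⟨Projectivization.mk ℂ _ h0, ⟨_, h0, hsq, rfl⟩, ?_⟩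
  rw [Projectivization.map_mk]
  conv_rhs => rw [← H.mk_rep]
  congr 1
  exact Q.apply_symm_apply H.rep

theorem map_mk_mulForm_mem_dualVariety (hn : 1 ≤ n) {f : BinaryForm n} (hf : f ≠ 0) :
    Projectivization.map (bombieriWeyl (2 * n)) (bombieriWeyl_injective (2 * n))
      (Projectivization.mk ℂ _ (mulForm_self_ne_zero hf)) ∈
        dualVariety (secantVariety n (rationalNormalCurve (2 * n))) := by
  intro d G hG hvan
  rw [Projectivization.map_mk, hG.rep_mk_eq_zero_iff]
  have hG' : IsForm (2 * d) fun f : BinaryForm n => G (bombieriWeyl (2 * n) (mulForm n f f)) :=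
    hG.comp fun l => isFormMap_mulForm_self n (l ∘ₗ bombieriWeyl (2 * n))
  obtain ⟨e, r, he, hr, rfl⟩ := exists_eq_smul_rootForm hf
  have hdist : ∀ r : Fin n → Fin 2 → ℂ, (∀ i, r i ≠ 0) →
      (∀ i j, i ≠ j → det₂ (r i) (r j) ≠ 0) →
      G (bombieriWeyl (2 * n) (mulForm n (rootForm r) (rootForm r))) = 0 := by
    intro r hr hdet
    obtain ⟨p, hp, hT⟩ := isSmoothPoint_sum_powForm hn hr hdet
    have hne := (map_ne_zero_iff _ (bombieriWeyl_injective (2 * n))).mpr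
      (mulForm_self_ne_zero (rootForm_ne_zero hr))
    rw [← hG.rep_mk_eq_zero_iff _ hne]
    refine hvan _ ⟨p, hp, fun w hw => ?_⟩
    obtain ⟨u, hu⟩ := Projectivization.exists_smul_eq_mk_rep ℂ _ hne
    rw [← hu, Units.smul_def, LinearMap.smul_apply, hT w hw, smul_zero]
  have hcont := hG'.continuous_comp
    (continuous_dual_of_continuous_eval (continuous_eval_rootForm r fun i => ![1, (i : ℂ)]))
  have h0 := eq_of_eventually_eq_punctured hcont continuous_const (by
    filter_upwards [eventually_distinct hr] with t ht
    exact hdist _ ht.1 ht.2)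
  simp only [zero_smul, add_zero] at h0
  have h1 := hG'.map_smul e (rootForm r)
  rw [h1, h0, mul_zero]

end Dual

theorem mainTheorem7 (n : ℕ) (hn : 1 ≤ n) :
    dualVariety (secantVariety n (rationalNormalCurve (2 * n))) =
        Projectivization.map (bombieriWeyl (2 * n)) (bombieriWeyl_injective (2 * n)) ''
          projectivize (squares n) ∧
      IsSmoothProjectiveVariety (projectivize (squares n)) ∧
      IsIsomorphicTo (projectivize (squares n))
        (Set.univ : Set (Projectivization ℂ (Fin (n + 1) → ℂ))) := by
  refine ⟨Set.Subset.antisymm (dualVariety_subset hn) ?_,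
    isSmoothProjectiveVariety_projectivize_squares n, isIsomorphicTo_projectivize_squares n⟩
  rintro _ ⟨_, ⟨_, hv, hs, rfl⟩, rfl⟩
  obtain ⟨f, rfl⟩ := mem_squares_iff.mp hs
  refine map_mk_mulForm_mem_dualVariety hn ?_
  rintro rfl
  simp at hv
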